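/- **Theorem.** There are absolute constants $C,c>0$ such that the following holds. For a real matrix $M$ let $\|M\|_F$ be its Frobenius norm, $\|M\|$ its spectral norm and, if $M\neq 0$, $\mathrm{sr}(M)=\|M\|_F^2/\|M\|^2$ its stable rank. A random vector $\mathbf x$ in $\mathbb R^p$ has the *convex concentration property with constant $K>0$* if for every convex function $\phi:\mathbb R^p\to\mathbb R$ that is $1$-Lipschitz for the Euclidean norm we have $\mathbb E|\phi(\mathbf x)|<\infty$ and $$\Pr\big[|\phi(\mathbf x)-\mathbb E\phi(\mathbf x)|\ge t\big]\le 2\exp(-t^2/K^2)\qquad\text{for all } t>0.$$ Let $X$ be a fixed nonzero real $n\times p$ matrix, and let $R$ be a random $p\times d$ matrix whose columns $\mathbf r_1,\dots,\mathbf r_d$ are independent, have mean zero, are isotropic (that is, $\mathbb E[\mathbf r_j\mathbf r_j^\top]=\mathbb I_p$), and have the convex concentration property with constant $K>0$. Let $\epsilon\in(0,1)$, and let $1\le k\le d$ be an integer such that $$\mathrm{sr}(X)\;\ge\; C K^4\,\frac{k}{\epsilon^2}\,\max\Big\{1,\log\frac dk\Big\}.$$ Then with probability at least $1-\exp\big(-c\,\epsilon^2\,\mathrm{sr}(X)/K^4\big)$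 the matrix $XR$ satisfies $(k,\epsilon)$-RIP, i.e., for all $\mathbf u\in\mathbb R^d$ with Euclidean norm $\|\mathbf u\|=1$ and at most $k$ nonzero coordinates, $$(1-\epsilon)\|X\|_F\le\|XR\mathbf u\|\le(1+\epsilon)\|X\|_F .$$ -/

import Mathlib

open MeasureTheory ProbabilityTheory

noncomputable section

namespace XRModel

/-- The Frobenius norm of a real matrix. -/
def frobNorm {n p : ℕ} (X : Matrix (Fin n) (Fin p) ℝ) : ℝ :=
  Real.sqrt (∑ i, ∑ j, X i j ^ 2)

/-- The spectral norm of a real matrix: its operator norm between Euclidean spaces. -/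
def specNorm {n p : ℕ} (X : Matrix (Fin n) (Fin p) ℝ) : ℝ :=
  ‖LinearMap.toContinuousLinearMap (Matrix.toEuclideanLin X)‖

/-- The stable rank of a real matrix (of a nonzero matrix; the zero matrix gets the value `0`). -/
def stableRank {n p : ℕ} (X : Matrix (Fin n) (Fin p) ℝ) : ℝ :=
  frobNorm X ^ 2 / specNorm X ^ 2

/-- `u` lies on the Euclidean unit sphere and has at most `k` nonzero coordinates. -/
def IsSparseUnit {d : ℕ} (k : ℕ) (u : EuclideanSpace ℝ (Fin d)) : Prop :=
  ‖u‖ = 1 ∧ {j : Fin d | u j ≠ 0}.ncard ≤ k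

/-- The product `X * R` satisfies the restricted isometry property of order `k` with
distortion `ε`, at the scale given by the Frobenius norm of `X`. -/
def ProductRIP {n p d : ℕ} (X : Matrix (Fin n) (Fin p) ℝ) (R : Matrix (Fin p) (Fin d) ℝ)
    (k : ℕ) (ε : ℝ) : Prop :=
  ∀ u : EuclideanSpace ℝ (Fin d), IsSparseUnit k u →
    (1 - ε) * frobNorm X ≤ ‖Matrix.toEuclideanLin (X * R) u‖ ∧
      ‖Matrix.toEuclideanLin (X * R) u‖ ≤ (1 + ε) * frobNorm X

/-- The `j`-th column of a matrix as a vector of Euclidean space. -/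
def column {p d : ℕ} (R : Matrix (Fin p) (Fin d) ℝ) (j : Fin d) : EuclideanSpace ℝ (Fin p) :=
  WithLp.toLp 2 (fun i => R i j)

/-- The convex concentration property with constant `K` of a random vector `x`. -/
def ConvexConcentration {Ω : Type*} [MeasurableSpace Ω] (μ : Measure Ω) {p : ℕ}
    (x : Ω → EuclideanSpace ℝ (Fin p)) (K : ℝ) : Prop :=
  ∀ φ : EuclideanSpace ℝ (Fin p) → ℝ, LipschitzWith 1 φ → ConvexOn ℝ Set.univ φ →
    Integrable (fun ω => φ (x ω)) μ ∧
      ∀ t : ℝ, 0 < t →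
        μ.real {ω | t ≤ |φ (x ω) - ∫ ω', φ (x ω') ∂μ|} ≤ 2 * Real.exp (-t ^ 2 / K ^ 2)

/-- The random vector `x` has mean zero. -/
def MeanZero {Ω : Type*} [MeasurableSpace Ω] (μ : Measure Ω) {p : ℕ}
    (x : Ω → EuclideanSpace ℝ (Fin p)) : Prop :=
  ∀ i : Fin p, Integrable (fun ω => x ω i) μ ∧ ∫ ω, x ω i ∂μ = 0

/-- The random vector `x` is isotropic: its second moment matrix is the identity. -/
def Isotropic {Ω : Type*} [MeasurableSpace Ω] (μ : Measure Ω) {p : ℕ}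
    (x : Ω → EuclideanSpace ℝ (Fin p)) : Prop :=
  ∀ i i' : Fin p, Integrable (fun ω => x ω i * x ω i') μ ∧
    ∫ ω, x ω i * x ω i' ∂μ = if i = i' then 1 else 0

end XRModel

end

namespace XRModel

/-! Write `L` for the operator of `X`, `S = ‖X‖_F²` and `r_j` for the columns of `R`. It suffices to
control `‖L (∑ u_j r_j)‖² - S` uniformly over sparse unit `u`. The core is a tail bound for one
fixed `u` (`measure_abs_norm_sq_sub_ge_le`), proved through exponential moments after a split into
two parts.

The diagonal part `∑ u_j² (‖L r_j‖² - S)` is a convex combination, so Jensen reduces it to one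
column. There `‖L ·‖` is convex and `‖L‖`-Lipschitz, hence concentrates, and isotropy identifies `S`
as the mean of its square (`lintegral_exp_norm_sq_sub_le`).

The off-diagonal part is an average, over subsets `I` of the columns, of `4⟨L A, L B⟩` with
independent `A = ∑_I u_j r_j` and `B = ∑_{Iᶜ} u_j r_j` (`sum_powerset_inner_sum_sdiff`). Both are
sub-Gaussian. Integrating out `B` leaves a quadratic form in `A`, which an auxiliary Gaussian vector
linearises (`SubGaussianVector.lintegral_exp_bilinear`).

Chernoff then gives a tail `46 exp(-c ε² sr(X)/K⁴)`. On each set of `k` coordinates, `25^k` test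
vectors control the whole quadratic form (`exists_quadratic_net`). The assumed lower bound on the
stable rank pays for the union over these vectors and over the `d.choose k` supports. -/

open Real in
theorem exp_le_add_exp_sq (x : ℝ) : exp x ≤ x + exp (x ^ 2) := by
  have h2 := add_one_le_exp (x ^ 2)
  rcases le_or_gt |x| 1 with h | h
  · have := (abs_le.1 (abs_exp_sub_one_sub_id_le h)).2
    linarith
  · rcases lt_abs.1 h with h | h
    · have : exp x ≤ exp (x ^ 2) := exp_le_exp.2 (by nlinarith)
      linarith
    · have : exp x ≤ 1 := exp_le_one_iff.2 (by linarith)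
      nlinarith

/-- Convexity bound for `exp (θ y)` when `θ ∈ [0, 1]`. -/
theorem exp_mul_le {θ : ℝ} (h0 : 0 ≤ θ) (h1 : θ ≤ 1) (y : ℝ) :
    Real.exp (θ * y) ≤ 1 - θ + θ * Real.exp y := by
  have := convexOn_exp.2 (Set.mem_univ (0 : ℝ)) (Set.mem_univ y) (sub_nonneg.2 h1) h0 (by ring)
  simpa using this

/-! ### Exponential moments of scalar variables with Gaussian tails -/

section Scalar

variable {Ω : Type*} [MeasurableSpace Ω] {μ : Measure Ω} [IsProbabilityMeasure μ]
  {W : Ω → ℝ} {σ : ℝ}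

/-- Layer-cake formula: for `t > 1` the level set is `|W| ≥ √(2σ² log t)`, of probability at most
`2t⁻²`. This contributes 2, and `t ≤ 1` contributes at most 1. The 2 in the exponent's denominator
is what makes the tail integrable. -/
theorem lintegral_exp_sq_le (hW : Measurable W) (hσ : 0 < σ)
    (htail : ∀ t, 0 < t → μ.real {ω | t ≤ |W ω|} ≤ 2 * Real.exp (-t ^ 2 / σ ^ 2)) :
    ∫⁻ ω, ENNReal.ofReal (Real.exp (W ω ^ 2 / (2 * σ ^ 2))) ∂μ ≤ 3 := by
  have hm : Measurable fun ω => Real.exp (W ω ^ 2 / (2 * σ ^ 2)) := by fun_prop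
  rw [lintegral_eq_lintegral_meas_le μ (.of_forall fun ω => (Real.exp_pos _).le) hm.aemeasurable,
    ← Set.Ioc_union_Ioi_eq_Ioi (zero_le_one' ℝ), lintegral_union measurableSet_Ioi
      (Set.Ioc_disjoint_Ioi le_rfl)]
  have h1 : ∫⁻ t in Set.Ioc (0 : ℝ) 1, μ {ω | t ≤ Real.exp (W ω ^ 2 / (2 * σ ^ 2))} ≤ 1 := by
    calc _ ≤ ∫⁻ t in Set.Ioc (0 : ℝ) 1, 1 := lintegral_mono fun t => prob_le_one
      _ = 1 := by simp
  have h2 : ∫⁻ t in Set.Ioi (1 : ℝ), μ {ω | t ≤ Real.exp (W ω ^ 2 / (2 * σ ^ 2))} ≤ 2 := by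
    have hb : ∀ t ∈ Set.Ioi (1 : ℝ), μ {ω | t ≤ Real.exp (W ω ^ 2 / (2 * σ ^ 2))} ≤
        ENNReal.ofReal (2 * t ^ (-2 : ℝ)) := by
      intro t ht
      have ht1 : (1 : ℝ) < t := ht
      have ht0 : 0 < t := by linarith
      have hl : 0 < Real.log t := Real.log_pos ht1
      have hp : 0 < 2 * σ ^ 2 * Real.log t := by positivity
      rw [← ofReal_measureReal]
      apply ENNReal.ofReal_le_ofReal
      calc _ ≤ μ.real {ω | √(2 * σ ^ 2 * Real.log t) ≤ |W ω|} := by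
            refine measureReal_mono (fun ω hω => ?_) (measure_ne_top _ _)
            have h3 : Real.log t ≤ W ω ^ 2 / (2 * σ ^ 2) := (Real.log_le_iff_le_exp ht0).2 hω
            rw [le_div_iff₀ (by positivity)] at h3
            exact Real.sqrt_le_iff.2 ⟨abs_nonneg _, by rw [sq_abs]; linarith⟩
        _ ≤ _ := htail _ (Real.sqrt_pos.2 hp)
        _ = _ := by
            rw [Real.sq_sqrt hp.le, Real.rpow_def_of_pos ht0]
            congr 2
            field_simp
    calc _ ≤ ∫⁻ t in Set.Ioi (1 : ℝ), ENNReal.ofReal (2 * t ^ (-2 : ℝ)) :=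
          setLIntegral_mono' measurableSet_Ioi hb
      _ = ENNReal.ofReal (∫ t in Set.Ioi (1 : ℝ), 2 * t ^ (-2 : ℝ)) := by
          rw [ofReal_integral_eq_lintegral_ofReal]
          · exact (integrableOn_Ioi_rpow_of_lt (by norm_num) zero_lt_one).const_mul 2
          · filter_upwards [ae_restrict_mem measurableSet_Ioi] with t ht
            have : (0 : ℝ) < t := zero_lt_one.trans ht
            simp only [Pi.zero_apply]
            positivity
      _ = 2 := by
          rw [integral_const_mul, integral_Ioi_rpow_of_lt (by norm_num) zero_lt_one]
          norm_num
  calc _ ≤ (1 : ENNReal) + 2 := add_le_add h1 h2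
    _ = 3 := by norm_num

omit [IsProbabilityMeasure μ] in
theorem integrable_exp_sq (hW : Measurable W)
    (h3 : ∫⁻ ω, ENNReal.ofReal (Real.exp (W ω ^ 2 / (2 * σ ^ 2))) ∂μ ≤ 3) :
    Integrable (fun ω => Real.exp (W ω ^ 2 / (2 * σ ^ 2))) μ ∧
      ∫ ω, Real.exp (W ω ^ 2 / (2 * σ ^ 2)) ∂μ ≤ 3 := by
  have hm : Measurable fun ω => Real.exp (W ω ^ 2 / (2 * σ ^ 2)) := by fun_prop
  constructor
  · refine ⟨hm.aestronglyMeasurable, ?_⟩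
    rw [hasFiniteIntegral_iff_ofReal (.of_forall fun ω => (Real.exp_pos _).le)]
    exact h3.trans_lt (by simp)
  · rw [integral_eq_lintegral_of_nonneg_ae (.of_forall fun ω => (Real.exp_pos _).le)
      hm.aestronglyMeasurable]
    exact ENNReal.toReal_mono (by simp) h3

theorem integral_sq_le (hW : Measurable W) (hσ : 0 < σ)
    (h3 : ∫⁻ ω, ENNReal.ofReal (Real.exp (W ω ^ 2 / (2 * σ ^ 2))) ∂μ ≤ 3) :
    Integrable (fun ω => W ω ^ 2) μ ∧ ∫ ω, W ω ^ 2 ∂μ ≤ 4 * σ ^ 2 := by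
  obtain ⟨hi, hb⟩ := integrable_exp_sq hW h3
  have hle : ∀ ω, W ω ^ 2 ≤ 2 * σ ^ 2 * (Real.exp (W ω ^ 2 / (2 * σ ^ 2)) - 1) := fun ω => by
    have := Real.add_one_le_exp (W ω ^ 2 / (2 * σ ^ 2))
    calc W ω ^ 2 = 2 * σ ^ 2 * (W ω ^ 2 / (2 * σ ^ 2)) := by field_simp
      _ ≤ _ := by gcongr; linarith
  have hi2 : Integrable (fun ω => 2 * σ ^ 2 * (Real.exp (W ω ^ 2 / (2 * σ ^ 2)) - 1)) μ :=
    (hi.sub (integrable_const 1)).const_mul _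
  have hi1 : Integrable (fun ω => W ω ^ 2) μ :=
    hi2.mono' (by fun_prop) (.of_forall fun ω => by
      rw [Real.norm_eq_abs, abs_of_nonneg (sq_nonneg _)]; exact hle ω)
  refine ⟨hi1, (integral_mono hi1 hi2 hle).trans ?_⟩
  rw [integral_const_mul, integral_sub hi (integrable_const 1)]
  simp only [integral_const, probReal_univ, smul_eq_mul, mul_one]
  nlinarith [sq_nonneg σ]

theorem lintegral_exp_mul_le (hW : Measurable W) (hσ : 0 < σ)
    (h3 : ∫⁻ ω, ENNReal.ofReal (Real.exp (W ω ^ 2 / (2 * σ ^ 2))) ∂μ ≤ 3)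
    (hWi : Integrable W μ) (hW0 : ∫ ω, W ω ∂μ = 0) (s : ℝ) :
    ∫⁻ ω, ENNReal.ofReal (Real.exp (s * W ω)) ∂μ ≤
      ENNReal.ofReal (Real.exp (4 * s ^ 2 * σ ^ 2)) := by
  obtain ⟨hi, hb⟩ := integrable_exp_sq hW h3
  have key : ∀ g : Ω → ℝ, Integrable g μ → (∀ ω, Real.exp (s * W ω) ≤ g ω) →
      ∫ ω, g ω ∂μ ≤ Real.exp (4 * s ^ 2 * σ ^ 2) →
      ∫⁻ ω, ENNReal.ofReal (Real.exp (s * W ω)) ∂μ ≤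
        ENNReal.ofReal (Real.exp (4 * s ^ 2 * σ ^ 2)) := by
    intro g hg hle hint
    calc _ ≤ ∫⁻ ω, ENNReal.ofReal (g ω) ∂μ :=
          lintegral_mono fun ω => ENNReal.ofReal_le_ofReal (hle ω)
      _ = ENNReal.ofReal (∫ ω, g ω ∂μ) :=
          (ofReal_integral_eq_lintegral_ofReal hg
            (.of_forall fun ω => (Real.exp_pos _).le.trans (hle ω))).symm
      _ ≤ _ := ENNReal.ofReal_le_ofReal hint
  -- With this `θ`, `(s W)² = θ · W²/(2σ²)`. For `θ ≤ 1`, the linear term of `exp x ≤ x + exp (x²)`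
  -- integrates to zero and convexity handles the rest.
  set θ := 2 * s ^ 2 * σ ^ 2 with hθ
  have hθ0 : 0 ≤ θ := by positivity
  rcases le_or_gt θ 1 with h1 | h1
  · have hB : Integrable (fun ω => (1 - θ) + θ * Real.exp (W ω ^ 2 / (2 * σ ^ 2))) μ :=
      (integrable_const _).add (hi.const_mul θ)
    refine key (fun ω => s * W ω + ((1 - θ) + θ * Real.exp (W ω ^ 2 / (2 * σ ^ 2))))
      ((hWi.const_mul s).add hB) (fun ω => ?_) ?_
    · have e : (s * W ω) ^ 2 = θ * (W ω ^ 2 / (2 * σ ^ 2)) := by rw [hθ]; field_simp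
      have := exp_le_add_exp_sq (s * W ω)
      rw [e] at this
      linarith [exp_mul_le hθ0 h1 (W ω ^ 2 / (2 * σ ^ 2))]
    · rw [integral_add (hWi.const_mul s) hB,
        integral_add (integrable_const _) (hi.const_mul θ), integral_const_mul, integral_const_mul,
        hW0]
      simp only [integral_const, probReal_univ, smul_eq_mul, one_mul]
      have := Real.add_one_le_exp (4 * s ^ 2 * σ ^ 2)
      nlinarith
  -- For `θ > 1` centring is not needed: by AM-GM `s W ≤ s²σ² + W²/(4σ²)`, and the resulting factor
  -- 2 is below `exp (3s²σ²)`.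
  · refine key (fun ω => Real.exp (s ^ 2 * σ ^ 2) *
      ((1 - 1 / 2) + 1 / 2 * Real.exp (W ω ^ 2 / (2 * σ ^ 2))))
      (((integrable_const _).add (hi.const_mul _)).const_mul _) (fun ω => ?_) ?_
    · calc Real.exp (s * W ω) ≤ Real.exp (s ^ 2 * σ ^ 2 + 1 / 2 * (W ω ^ 2 / (2 * σ ^ 2))) := by
            apply Real.exp_le_exp.2
            have : s ^ 2 * σ ^ 2 + 1 / 2 * (W ω ^ 2 / (2 * σ ^ 2)) - s * W ω =
              (s * σ - W ω / (2 * σ)) ^ 2 := by field_simp; ring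
            nlinarith [sq_nonneg (s * σ - W ω / (2 * σ))]
        _ ≤ _ := by
            rw [Real.exp_add]
            gcongr
            exact exp_mul_le (by norm_num) (by norm_num) _
    · rw [integral_const_mul, integral_add (integrable_const _) (hi.const_mul _),
        integral_const_mul]
      simp only [integral_const, probReal_univ, smul_eq_mul, one_mul]
      calc _ ≤ Real.exp (s ^ 2 * σ ^ 2) * 2 := by gcongr; linarith
        _ ≤ Real.exp (s ^ 2 * σ ^ 2) * Real.exp (3 * s ^ 2 * σ ^ 2) := by
            gcongr
            have := Real.add_one_le_exp (3 * s ^ 2 * σ ^ 2)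
            nlinarith
        _ = _ := by rw [← Real.exp_add]; ring_nf

end Scalar

/-! ### Gaussian integrals -/

/-- At `b = 1/4` the integrand times the density is `√2` times the density of variance 2. Convexity
interpolates between this and `b = 0`. -/
theorem lintegral_exp_sq_gaussian {b : ℝ} (h0 : 0 ≤ b) (h1 : 4 * b ≤ 1) :
    ∫⁻ x, ENNReal.ofReal (Real.exp (b * x ^ 2)) ∂gaussianReal 0 1 ≤
      ENNReal.ofReal (Real.exp (2 * b)) := by
  have hq : ∫⁻ x, ENNReal.ofReal (Real.exp (x ^ 2 / 4)) ∂gaussianReal 0 1 =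
      ENNReal.ofReal √2 := by
    rw [gaussianReal_of_var_ne_zero _ one_ne_zero,
      lintegral_withDensity_eq_lintegral_mul _ (measurable_gaussianPDF _ _) (by fun_prop)]
    have : ∀ x : ℝ, (gaussianPDF 0 1 * fun x => ENNReal.ofReal (Real.exp (x ^ 2 / 4))) x =
        ENNReal.ofReal √2 * gaussianPDF 0 2 x := fun x => by
      rw [Pi.mul_apply, gaussianPDF, gaussianPDF, ← ENNReal.ofReal_mul (gaussianPDFReal_nonneg _ _ _),
        ← ENNReal.ofReal_mul (Real.sqrt_nonneg _), gaussianPDFReal, gaussianPDFReal, mul_assoc,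
        ← Real.exp_add, ← mul_assoc]
      congr 2
      · have h2 : √(2 * Real.pi * (2 : NNReal)) = √2 * √(2 * Real.pi * (1 : NNReal)) := by
          rw [← Real.sqrt_mul zero_le_two]
          congr 1
          push_cast
          ring
        rw [h2, mul_inv, ← mul_assoc, mul_inv_cancel₀ (by positivity), one_mul]
      · push_cast
        ring_nf
    simp_rw [this]
    rw [lintegral_const_mul _ (measurable_gaussianPDF _ _),
      lintegral_gaussianPDF_eq_one _ two_ne_zero, mul_one]
  calc _ ≤ ∫⁻ x, (ENNReal.ofReal (1 - 4 * b) +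
          ENNReal.ofReal (4 * b) * ENNReal.ofReal (Real.exp (x ^ 2 / 4))) ∂gaussianReal 0 1 := by
        refine lintegral_mono fun x => ?_
        rw [← ENNReal.ofReal_mul (by positivity),
          ← ENNReal.ofReal_add (by linarith) (by positivity)]
        apply ENNReal.ofReal_le_ofReal
        have := exp_mul_le (θ := 4 * b) (by positivity) h1 (x ^ 2 / 4)
        rwa [show 4 * b * (x ^ 2 / 4) = b * x ^ 2 by ring] at this
    _ = ENNReal.ofReal ((1 - 4 * b) + 4 * b * √2) := by
        rw [lintegral_add_left measurable_const, lintegral_const_mul _ (by fun_prop), hq,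
          lintegral_const, measure_univ, mul_one, ← ENNReal.ofReal_mul (by positivity),
          ← ENNReal.ofReal_add (by linarith) (by positivity)]
    _ ≤ _ := by
        apply ENNReal.ofReal_le_ofReal
        have h2 : √2 ≤ 3 / 2 := Real.sqrt_le_iff.2 ⟨by norm_num, by norm_num⟩
        have := Real.add_one_le_exp (2 * b)
        nlinarith

section Pi

variable {ι : Type*} [Fintype ι]

theorem lintegral_gaussian_prod (f : ι → ℝ → ENNReal) (hf : ∀ i, Measurable (f i)) :
    ∫⁻ g, ∏ i, f i (g i) ∂Measure.pi (fun _ : ι => gaussianReal 0 1) =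
      ∏ i, ∫⁻ x, f i x ∂gaussianReal 0 1 := by
  rw [lintegral_prod_eq_prod_lintegral_of_indepFun Finset.univ (fun i (g : ι → ℝ) => f i (g i))
    (iIndepFun_pi fun i => (hf i).aemeasurable)
    (fun i => (hf i).comp (measurable_pi_apply i))]
  refine Finset.prod_congr rfl fun i _ => ?_
  exact (measurePreserving_eval (fun _ : ι => gaussianReal 0 1) i).lintegral_comp (hf i)

omit [Fintype ι] in
theorem ofReal_exp_sum (s : Finset ι) (f : ι → ℝ) :
    ENNReal.ofReal (Real.exp (∑ i ∈ s, f i)) = ∏ i ∈ s, ENNReal.ofReal (Real.exp (f i)) := by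
  rw [Real.exp_sum, ENNReal.ofReal_prod_of_nonneg fun i _ => (Real.exp_pos _).le]

/-- Read from right to left, this turns a quadratic exponent into a linear one at the price of an
auxiliary Gaussian vector. -/
theorem lintegral_exp_linear_gaussian (a : ι → ℝ) :
    ∫⁻ g, ENNReal.ofReal (Real.exp (∑ i, a i * g i)) ∂Measure.pi (fun _ : ι => gaussianReal 0 1) =
      ENNReal.ofReal (Real.exp (∑ i, a i ^ 2 / 2)) := by
  simp_rw [ofReal_exp_sum]
  rw [lintegral_gaussian_prod (fun i x => ENNReal.ofReal (Real.exp (a i * x)))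
    (fun i => by fun_prop)]
  refine Finset.prod_congr rfl fun i _ => ?_
  rw [← ofReal_integral_eq_lintegral_ofReal (integrable_exp_mul_gaussianReal _)
    (.of_forall fun x => (Real.exp_pos _).le)]
  have := congrFun (mgf_id_gaussianReal (μ := 0) (v := 1)) (a i)
  simp only [mgf, id] at this
  rw [this]
  simp

end Pi

/-! ### Sub-Gaussian vectors and their quadratic forms -/

section Vector

variable {Ω : Type*} [MeasurableSpace Ω] {μ : Measure Ω} [IsProbabilityMeasure μ]
  {E : Type*} [NormedAddCommGroup E] [InnerProductSpace ℝ E] [MeasurableSpace E] [BorelSpace E]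
  [SecondCountableTopology E]

/-- The random vector `A` is sub-Gaussian with variance proxy `2 * v`. -/
def SubGaussianVector (μ : Measure Ω) (A : Ω → E) (v : ℝ) : Prop :=
  ∀ a : E, ∫⁻ ω, ENNReal.ofReal (Real.exp (inner ℝ a (A ω))) ∂μ ≤
    ENNReal.ofReal (Real.exp (v * ‖a‖ ^ 2))

omit [IsProbabilityMeasure μ] in
-- Proxies of independent summands add with weights `u i ^ 2`. An inequality for the total weight is
-- enough, as needed for the partial sums in the decoupling.
theorem SubGaussianVector.sum {ι : Type*} {r : ι → Ω → E} {v : ℝ} (hv : 0 ≤ v)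
    (hr : ∀ i, Measurable (r i)) (hind : iIndepFun r μ) (h : ∀ i, SubGaussianVector μ (r i) v)
    (u : ι → ℝ) (I : Finset ι) (hu : ∑ i ∈ I, u i ^ 2 ≤ 1) :
    SubGaussianVector μ (fun ω => ∑ i ∈ I, u i • r i ω) v := by
  intro a
  have e : ∀ ω, ENNReal.ofReal (Real.exp (inner ℝ a (∑ i ∈ I, u i • r i ω))) =
      ∏ i ∈ I, ENNReal.ofReal (Real.exp (inner ℝ (u i • a) (r i ω))) := fun ω => by
    rw [← ofReal_exp_sum, inner_sum]
    simp_rw [real_inner_smul_left, real_inner_smul_right]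
  simp_rw [e]
  rw [lintegral_prod_eq_prod_lintegral_of_indepFun I
    (fun i ω => ENNReal.ofReal (Real.exp (inner ℝ (u i • a) (r i ω))))
    (hind.comp (fun i x => ENNReal.ofReal (Real.exp (inner ℝ (u i • a) x)))
      fun i => by fun_prop) (fun i => by fun_prop)]
  calc _ ≤ ∏ i ∈ I, ENNReal.ofReal (Real.exp (v * ‖u i • a‖ ^ 2)) :=
        Finset.prod_le_prod' fun i _ => h i _
    _ = ENNReal.ofReal (Real.exp (∑ i ∈ I, v * ‖u i • a‖ ^ 2)) := (ofReal_exp_sum _ _).symm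
    _ ≤ _ := by
        apply ENNReal.ofReal_le_ofReal
        apply Real.exp_le_exp.2
        simp_rw [norm_smul, mul_pow, Real.norm_eq_abs, sq_abs]
        rw [← Finset.mul_sum, ← Finset.sum_mul]
        gcongr
        exact mul_le_of_le_one_left (sq_nonneg _) hu

/-- Linearise with Gaussian weights `√2 w_i g_i`, exchange the integrals and apply sub-Gaussianity
for fixed `g`. Orthonormality makes the result a product of one-dimensional integrals with `b = 2 v
w_i²`. -/
theorem SubGaussianVector.lintegral_exp_quadratic {ι : Type*} [Fintype ι] {A : Ω → E} {v : ℝ}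
    (hv : 0 ≤ v) (hA : Measurable A) (h : SubGaussianVector μ A v) {b : ι → E}
    (hb : Orthonormal ℝ b) (w : ι → ℝ) (hw : ∀ i, 8 * v * w i ^ 2 ≤ 1) :
    ∫⁻ ω, ENNReal.ofReal (Real.exp (∑ i, w i ^ 2 * inner ℝ (b i) (A ω) ^ 2)) ∂μ ≤
      ENNReal.ofReal (Real.exp (4 * v * ∑ i, w i ^ 2)) := by
  have e1 : ∀ ω, ENNReal.ofReal (Real.exp (∑ i, w i ^ 2 * inner ℝ (b i) (A ω) ^ 2)) =
      ∫⁻ g, ENNReal.ofReal (Real.exp (inner ℝ (∑ i, (√2 * w i * g i) • b i) (A ω)))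
        ∂Measure.pi (fun _ : ι => gaussianReal 0 1) := fun ω => by
    have e : ∀ g : ι → ℝ, inner ℝ (∑ i, (√2 * w i * g i) • b i) (A ω) =
        ∑ i, (√2 * w i * inner ℝ (b i) (A ω)) * g i := fun g => by
      rw [sum_inner]
      refine Finset.sum_congr rfl fun i _ => ?_
      rw [real_inner_smul_left]
      ring
    simp_rw [e]
    rw [lintegral_exp_linear_gaussian]
    congr 3
    funext i
    rw [mul_pow, mul_pow, Real.sq_sqrt zero_le_two]
    ring
  have e2 : ∀ g : ι → ℝ, v * ‖∑ i, (√2 * w i * g i) • b i‖ ^ 2 =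
      ∑ i, 2 * v * w i ^ 2 * g i ^ 2 := fun g => by
    rw [← real_inner_self_eq_norm_sq, hb.inner_sum, Finset.mul_sum]
    refine Finset.sum_congr rfl fun i _ => ?_
    have := Real.sq_sqrt zero_le_two
    simp only [conj_trivial]
    linear_combination (v * w i ^ 2 * g i ^ 2) * this
  simp_rw [e1]
  rw [lintegral_lintegral_swap]
  · calc _ ≤ ∫⁻ g, ENNReal.ofReal (Real.exp (v * ‖∑ i, (√2 * w i * g i) • b i‖ ^ 2))
          ∂Measure.pi (fun _ : ι => gaussianReal 0 1) := lintegral_mono fun g => h _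
      _ = ∏ i, ∫⁻ x, ENNReal.ofReal (Real.exp (2 * v * w i ^ 2 * x ^ 2)) ∂gaussianReal 0 1 := by
          simp_rw [e2, ofReal_exp_sum]
          exact lintegral_gaussian_prod
            (fun i x => ENNReal.ofReal (Real.exp (2 * v * w i ^ 2 * x ^ 2))) fun i => by fun_prop
      _ ≤ ∏ i, ENNReal.ofReal (Real.exp (2 * (2 * v * w i ^ 2))) :=
          Finset.prod_le_prod' fun i _ => lintegral_exp_sq_gaussian (by positivity)
            (by linarith [hw i])
      _ = _ := by
          rw [← ofReal_exp_sum, Finset.mul_sum]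
          congr 3
          funext i
          ring
  · apply Measurable.aemeasurable
    unfold Function.uncurry
    fun_prop

end Vector

/-! ### Singular vectors and the decoupling identity -/

section Algebra

variable {F : Type*} [NormedAddCommGroup F] [InnerProductSpace ℝ F]

/-- Eigenvectors of `L* L` are right singular vectors. Writing the singular values as `‖L (b i)‖`
makes the sum of their squares the squared Hilbert–Schmidt norm. -/
theorem exists_singular_basis {E : Type*} [NormedAddCommGroup E] [InnerProductSpace ℝ E]
    [FiniteDimensional ℝ E] [FiniteDimensional ℝ F] (L : E →L[ℝ] F) :
    ∃ b : OrthonormalBasis (Fin (Module.finrank ℝ E)) ℝ E, ∀ x y : E,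
      inner ℝ (L x) (L y) = ∑ i, ‖L (b i)‖ ^ 2 * (inner ℝ (b i) x * inner ℝ (b i) y) := by
  let T : E →ₗ[ℝ] E := LinearMap.adjoint (L : E →ₗ[ℝ] F) ∘ₗ (L : E →ₗ[ℝ] F)
  have hTi : ∀ x y, inner ℝ (T x) y = inner ℝ (L x) (L y) := fun x y =>
    LinearMap.adjoint_inner_left (L : E →ₗ[ℝ] F) y (L x)
  have hT : T.IsSymmetric := fun x y => by
    rw [hTi, real_inner_comm, ← hTi, real_inner_comm]
  refine ⟨hT.eigenvectorBasis rfl, fun x y => ?_⟩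
  set b := hT.eigenvectorBasis rfl
  have hb : ∀ i z, inner ℝ (L (b i)) (L z) = ‖L (b i)‖ ^ 2 * inner ℝ (b i) z := fun i z => by
    have h1 : ∀ z, inner ℝ (L (b i)) (L z) = hT.eigenvalues rfl i * inner ℝ (b i) z := fun z => by
      rw [← hTi, hT.apply_eigenvectorBasis rfl i, real_inner_smul_left]
      rfl
    have h2 := h1 (b i)
    rw [real_inner_self_eq_norm_sq, real_inner_self_eq_norm_sq, b.orthonormal.1 i] at h2
    rw [h1, h2]
    ring
  conv_lhs => rw [← b.sum_repr' x]
  rw [map_sum, sum_inner]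
  refine Finset.sum_congr rfl fun i _ => ?_
  rw [map_smul, real_inner_smul_left, hb]
  ring

/-- For `i ≠ j`, exactly a quarter of the subsets `I` contain `i` but not `j`, whence the factor 4.
-/
theorem sum_powerset_inner_sum_sdiff {ι : Type*} [DecidableEq ι] (y : ι → F) (S : Finset ι) :
    ∑ I ∈ S.powerset, 4 * inner ℝ (∑ i ∈ I, y i) (∑ i ∈ S \ I, y i) =
      2 ^ S.card * (‖∑ i ∈ S, y i‖ ^ 2 - ∑ i ∈ S, ‖y i‖ ^ 2) := by
  induction S using Finset.induction_on with
  | empty => simp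
  | insert a S ha ih =>
    have h : ∀ I ∈ S.powerset,
        4 * inner ℝ (∑ i ∈ I, y i) (∑ i ∈ insert a S \ I, y i) +
          4 * inner ℝ (∑ i ∈ insert a I, y i) (∑ i ∈ insert a S \ insert a I, y i) =
        2 * (4 * inner ℝ (∑ i ∈ I, y i) (∑ i ∈ S \ I, y i)) +
          4 * inner ℝ (y a) (∑ i ∈ S, y i) := fun I hI => by
      have hIS := Finset.mem_powerset.1 hI
      have haI : a ∉ I := fun h => ha (hIS h)
      rw [Finset.insert_sdiff_of_notMem _ haI, Finset.insert_sdiff_insert,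
        Finset.sdiff_insert_of_notMem ha, Finset.sum_insert (by simp [ha]),
        Finset.sum_insert haI, ← Finset.sum_sdiff hIS, inner_add_right, inner_add_left,
        inner_add_right, real_inner_comm (y a)]
      ring
    rw [Finset.sum_powerset_insert ha, ← Finset.sum_add_distrib, Finset.sum_congr rfl h,
      Finset.sum_add_distrib, ← Finset.mul_sum, ih, Finset.sum_const, Finset.card_powerset,
      Finset.card_insert_of_notMem ha, Finset.sum_insert ha, Finset.sum_insert ha,
      norm_add_sq_real, nsmul_eq_mul]
    push_cast
    ring

end Algebra

/-! ### Exponential moments: convex combinations, centred squares, decoupled forms -/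

section Prob

variable {Ω : Type*} [MeasurableSpace Ω] {μ : Measure Ω}

theorem lintegral_exp_convexComb_le {κ : Type*} (s : Finset κ) (w : κ → ℝ) (f : κ → Ω → ℝ)
    (hw : ∀ i ∈ s, 0 ≤ w i) (hw1 : ∑ i ∈ s, w i = 1) (hf : ∀ i, Measurable (f i)) (M : ENNReal)
    (hM : ∀ i ∈ s, ∫⁻ ω, ENNReal.ofReal (Real.exp (f i ω)) ∂μ ≤ M) :
    ∫⁻ ω, ENNReal.ofReal (Real.exp (∑ i ∈ s, w i * f i ω)) ∂μ ≤ M := by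
  calc _ ≤ ∫⁻ ω, ∑ i ∈ s, ENNReal.ofReal (w i) * ENNReal.ofReal (Real.exp (f i ω)) ∂μ := by
        refine lintegral_mono fun ω => ?_
        have := convexOn_exp.map_sum_le (p := fun i => f i ω) hw hw1 fun i _ => Set.mem_univ _
        simp only [smul_eq_mul] at this
        refine (ENNReal.ofReal_le_ofReal this).trans ?_
        rw [ENNReal.ofReal_sum_of_nonneg fun i hi => mul_nonneg (hw i hi) (Real.exp_pos _).le]
        refine Finset.sum_le_sum fun i hi => ?_
        rw [ENNReal.ofReal_mul (hw i hi)]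
    _ = ∑ i ∈ s, ENNReal.ofReal (w i) * ∫⁻ ω, ENNReal.ofReal (Real.exp (f i ω)) ∂μ := by
        rw [lintegral_finsetSum _ fun i _ => by fun_prop]
        refine Finset.sum_congr rfl fun i _ => ?_
        rw [lintegral_const_mul _ (by fun_prop)]
    _ ≤ ∑ i ∈ s, ENNReal.ofReal (w i) * M := by
        gcongr with i hi
        exact hM i hi
    _ = M := by
        rw [← Finset.sum_mul, ← ENNReal.ofReal_sum_of_nonneg hw, hw1, ENNReal.ofReal_one, one_mul]

/-- Convexity at the midpoint of `2f` and `2g`: dependent terms are separated at the cost of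
doubling the exponents. -/
theorem lintegral_exp_add_le {f g : Ω → ℝ} (hf : Measurable f) (hg : Measurable g) (M : ENNReal)
    (h1 : ∫⁻ ω, ENNReal.ofReal (Real.exp (2 * f ω)) ∂μ ≤ M)
    (h2 : ∫⁻ ω, ENNReal.ofReal (Real.exp (2 * g ω)) ∂μ ≤ M) :
    ∫⁻ ω, ENNReal.ofReal (Real.exp (f ω + g ω)) ∂μ ≤ M := by
  have := lintegral_exp_convexComb_le (μ := μ) Finset.univ (fun _ : Bool => 1 / 2)
    (fun i ω => if i then 2 * f ω else 2 * g ω) (fun _ _ => by norm_num) (by norm_num)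
    (fun i => by cases i <;> simp <;> fun_prop) M (fun i _ => by cases i <;> simpa)
  convert this using 5 with ω
  simp

theorem exp_two_lt : Real.exp 2 ≤ 23 / 3 := by
  have h := Real.exp_one_lt_d9
  have : Real.exp 2 = Real.exp 1 ^ 2 := by rw [← Real.exp_nat_mul]; norm_num
  rw [this]
  nlinarith [Real.exp_pos 1]

/-- For `W = Y - m` with `m` the mean of `Y`, the exponent is `l (Y² - 𝔼Y²)`. The part linear in `W`
is sub-Gaussian. The square is bounded without using its centring, for a factor `3e² ≤ 23` that
later only affects constants. -/
theorem lintegral_exp_centered_sq_le [IsProbabilityMeasure μ] {W : Ω → ℝ} {σ m l : ℝ}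
    (hW : Measurable W) (hσ : 0 < σ)
    (h3 : ∫⁻ ω, ENNReal.ofReal (Real.exp (W ω ^ 2 / (2 * σ ^ 2))) ∂μ ≤ 3)
    (hWi : Integrable W μ) (hW0 : ∫ ω, W ω ∂μ = 0) (hl : 4 * |l| * σ ^ 2 ≤ 1) :
    ∫⁻ ω, ENNReal.ofReal (Real.exp (l * (2 * m * W ω + (W ω ^ 2 - ∫ ω, W ω ^ 2 ∂μ)))) ∂μ ≤
      ENNReal.ofReal (23 * Real.exp (64 * l ^ 2 * m ^ 2 * σ ^ 2)) := by
  have hV := (integral_sq_le hW hσ h3).2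
  have hV0 : 0 ≤ ∫ ω, W ω ^ 2 ∂μ := integral_nonneg fun ω => sq_nonneg _
  set V := ∫ ω, W ω ^ 2 ∂μ
  have he : 1 ≤ Real.exp (64 * l ^ 2 * m ^ 2 * σ ^ 2) := Real.one_le_exp (by positivity)
  have := lintegral_exp_add_le (μ := μ) (f := fun ω => l * (2 * m * W ω))
    (g := fun ω => l * (W ω ^ 2 - V)) (by fun_prop) (by fun_prop)
    (ENNReal.ofReal (23 * Real.exp (64 * l ^ 2 * m ^ 2 * σ ^ 2))) ?_ ?_
  · simpa only [mul_add] using this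
  · have h := lintegral_exp_mul_le hW hσ h3 hWi hW0 (4 * l * m)
    simp_rw [show ∀ ω, 2 * (l * (2 * m * W ω)) = 4 * l * m * W ω from fun ω => by ring]
    refine h.trans (ENNReal.ofReal_le_ofReal ?_)
    rw [show 4 * (4 * l * m) ^ 2 * σ ^ 2 = 64 * l ^ 2 * m ^ 2 * σ ^ 2 by ring]
    linarith
  · calc _ ≤ ∫⁻ ω, ENNReal.ofReal (Real.exp 2) *
          ENNReal.ofReal (Real.exp (W ω ^ 2 / (2 * σ ^ 2))) ∂μ := by
          refine lintegral_mono fun ω => ?_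
          rw [← ENNReal.ofReal_mul (Real.exp_pos _).le, ← Real.exp_add]
          apply ENNReal.ofReal_le_ofReal
          apply Real.exp_le_exp.2
          have h1 : 2 * |l| ≤ 1 / (2 * σ ^ 2) := by
            rw [le_div_iff₀ (by positivity)]; linarith
          have h2 : 2 * (l * (W ω ^ 2 - V)) ≤ 2 * |l| * W ω ^ 2 + 2 * |l| * V := by
            have := neg_abs_le l
            have := le_abs_self l
            nlinarith [sq_nonneg (W ω)]
          have h4 : 2 * |l| * V ≤ 2 := by
            calc _ ≤ 2 * |l| * (4 * σ ^ 2) := by gcongr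
              _ ≤ 2 := by linarith
          have h5 : 2 * |l| * W ω ^ 2 ≤ W ω ^ 2 / (2 * σ ^ 2) := by
            calc _ ≤ 1 / (2 * σ ^ 2) * W ω ^ 2 := by gcongr
              _ = _ := by ring
          linarith
      _ ≤ ENNReal.ofReal (Real.exp 2) * 3 := by
          rw [lintegral_const_mul _ (by fun_prop)]
          gcongr
      _ ≤ _ := by
          rw [show (3 : ENNReal) = ENNReal.ofReal 3 by norm_num,
            ← ENNReal.ofReal_mul (Real.exp_pos _).le]
          apply ENNReal.ofReal_le_ofReal
          linarith [exp_two_lt]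

variable {E : Type*} [NormedAddCommGroup E] [InnerProductSpace ℝ E] [MeasurableSpace E]
  [BorelSpace E] [FiniteDimensional ℝ E] {F : Type*} [NormedAddCommGroup F]
  [InnerProductSpace ℝ F]

/-- For fixed `A = x`, sub-Gaussianity of `B` gives `exp (v ‖T x‖²)` with `T = θ L* L`, diagonal in
`b`. The quadratic bound for `A` then involves `∑ ‖L (b i)‖⁴ ≤ ‖L‖² ∑ ‖L (b i)‖²`, which is how the
stable rank arises. -/
theorem SubGaussianVector.lintegral_exp_bilinear [IsProbabilityMeasure μ] {κ : Type*} [Fintype κ]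
    (L : E →L[ℝ] F) (b : OrthonormalBasis κ ℝ E)
    (hb : ∀ x y : E,
      inner ℝ (L x) (L y) = ∑ i, ‖L (b i)‖ ^ 2 * (inner ℝ (b i) x * inner ℝ (b i) y))
    {A B : Ω → E} {v θ : ℝ} (hv : 0 ≤ v) (hA : Measurable A) (hB : Measurable B)
    (hAB : IndepFun A B μ) (hsA : SubGaussianVector μ A v) (hsB : SubGaussianVector μ B v)
    (hθ : 8 * v ^ 2 * θ ^ 2 * ‖L‖ ^ 4 ≤ 1) :
    ∫⁻ ω, ENNReal.ofReal (Real.exp (θ * inner ℝ (L (A ω)) (L (B ω)))) ∂μ ≤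
      ENNReal.ofReal (Real.exp (4 * v ^ 2 * θ ^ 2 * ‖L‖ ^ 2 * ∑ i, ‖L (b i)‖ ^ 2)) := by
  have : ProperSpace E := FiniteDimensional.proper ℝ E
  let T : E → E := fun x => ∑ i, (θ * ‖L (b i)‖ ^ 2 * inner ℝ (b i) x) • b i
  have hT : ∀ x y, inner ℝ (T x) y = θ * inner ℝ (L x) (L y) := fun x y => by
    simp only [T]
    rw [hb, sum_inner, Finset.mul_sum]
    refine Finset.sum_congr rfl fun i _ => ?_
    rw [real_inner_smul_left]
    ring
  let w : κ → ℝ := fun i => √v * θ * ‖L (b i)‖ ^ 2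
  have hw2 : ∀ i, w i ^ 2 = v * θ ^ 2 * ‖L (b i)‖ ^ 4 := fun i => by
    simp only [w, mul_pow, Real.sq_sqrt hv]
    ring
  have hLb : ∀ i, ‖L (b i)‖ ≤ ‖L‖ := fun i => by
    have := L.le_opNorm (b i)
    rwa [b.orthonormal.1 i, mul_one] at this
  have hTn : ∀ x, v * ‖T x‖ ^ 2 = ∑ i, w i ^ 2 * inner ℝ (b i) x ^ 2 := fun x => by
    rw [← real_inner_self_eq_norm_sq, b.orthonormal.inner_sum, Finset.mul_sum]
    refine Finset.sum_congr rfl fun i _ => ?_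
    rw [hw2]
    simp only [conj_trivial]
    ring
  have hmap := (indepFun_iff_map_prod_eq_prod_map_map hA.aemeasurable hB.aemeasurable).1 hAB
  have : IsProbabilityMeasure (μ.map B) := Measure.isProbabilityMeasure_map hB.aemeasurable
  have hmL : Measurable fun z : E × E => ENNReal.ofReal (Real.exp (θ * inner ℝ (L z.1) (L z.2))) := by
    have : Continuous fun z : E × E => Real.exp (θ * inner ℝ (L z.1) (L z.2)) := by fun_prop
    exact this.measurable.ennreal_ofReal
  calc ∫⁻ ω, ENNReal.ofReal (Real.exp (θ * inner ℝ (L (A ω)) (L (B ω)))) ∂μ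
      = ∫⁻ z, ENNReal.ofReal (Real.exp (θ * inner ℝ (L z.1) (L z.2)))
          ∂μ.map (fun ω => (A ω, B ω)) := (lintegral_map hmL (hA.prodMk hB)).symm
    _ = ∫⁻ x, ∫⁻ y, ENNReal.ofReal (Real.exp (θ * inner ℝ (L x) (L y))) ∂μ.map B ∂μ.map A := by
        rw [hmap, lintegral_prod _ hmL.aemeasurable]
    _ ≤ ∫⁻ x, ENNReal.ofReal (Real.exp (v * ‖T x‖ ^ 2)) ∂μ.map A := by
        refine lintegral_mono fun x => ?_
        simp_rw [← hT]
        rw [lintegral_map (by fun_prop) hB]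
        exact hsB _
    _ = ∫⁻ ω, ENNReal.ofReal (Real.exp (∑ i, w i ^ 2 * inner ℝ (b i) (A ω) ^ 2)) ∂μ := by
        simp_rw [hTn]
        rw [lintegral_map (by fun_prop) hA]
    _ ≤ ENNReal.ofReal (Real.exp (4 * v * ∑ i, w i ^ 2)) := by
        refine hsA.lintegral_exp_quadratic hv hA b.orthonormal w fun i => ?_
        rw [hw2]
        calc _ = 8 * v ^ 2 * θ ^ 2 * ‖L (b i)‖ ^ 4 := by ring
          _ ≤ 8 * v ^ 2 * θ ^ 2 * ‖L‖ ^ 4 := by gcongr; exact hLb i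
          _ ≤ 1 := hθ
    _ ≤ _ := by
        apply ENNReal.ofReal_le_ofReal
        apply Real.exp_le_exp.2
        rw [Finset.mul_sum, Finset.mul_sum]
        refine Finset.sum_le_sum fun i _ => ?_
        rw [hw2]
        calc _ = 4 * v ^ 2 * θ ^ 2 * ‖L (b i)‖ ^ 2 * ‖L (b i)‖ ^ 2 := by ring
          _ ≤ _ := by gcongr; exact hLb i

/-- Jensen moves the average over subsets outside the exponential. For each subset the two partial
sums are independent, and the bilinear bound applies with `θ = 4l`. -/
theorem lintegral_exp_offDiagonal_le [IsProbabilityMeasure μ] {κ ι : Type*} [Fintype κ] [Fintype ι]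
    (L : E →L[ℝ] F) (b : OrthonormalBasis κ ℝ E)
    (hb : ∀ x y : E,
      inner ℝ (L x) (L y) = ∑ i, ‖L (b i)‖ ^ 2 * (inner ℝ (b i) x * inner ℝ (b i) y))
    {r : ι → Ω → E} {v l : ℝ} (hv : 0 ≤ v) (hr : ∀ i, Measurable (r i)) (hind : iIndepFun r μ)
    (hsub : ∀ i, SubGaussianVector μ (r i) v) (u : ι → ℝ) (hu : ∑ i, u i ^ 2 = 1)
    (hl : 128 * v ^ 2 * l ^ 2 * ‖L‖ ^ 4 ≤ 1) :
    ∫⁻ ω, ENNReal.ofReal (Real.exp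
      (l * (‖L (∑ i, u i • r i ω)‖ ^ 2 - ∑ i, u i ^ 2 * ‖L (r i ω)‖ ^ 2))) ∂μ ≤
      ENNReal.ofReal (Real.exp (64 * v ^ 2 * l ^ 2 * ‖L‖ ^ 2 * ∑ i, ‖L (b i)‖ ^ 2)) := by
  classical
  have : ProperSpace E := FiniteDimensional.proper ℝ E
  have hsum : ∀ I : Finset ι, Measurable fun ω => ∑ i ∈ I, u i • r i ω := fun I => by fun_prop
  have hcard : (2 : ℝ) ^ (Finset.univ : Finset ι).card ≠ 0 := by positivity
  have key := lintegral_exp_convexComb_le (μ := μ) (Finset.univ : Finset ι).powerset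
    (fun _ => ((2 : ℝ) ^ (Finset.univ : Finset ι).card)⁻¹)
    (fun I ω => 4 * l * inner ℝ (L (∑ i ∈ I, u i • r i ω))
      (L (∑ i ∈ Finset.univ \ I, u i • r i ω)))
    (fun _ _ => by positivity) (by simp) (fun I => by
      have hc : Continuous fun z : E × E => 4 * l * inner ℝ (L z.1) (L z.2) := by fun_prop
      exact hc.measurable.comp ((hsum I).prodMk (hsum (Finset.univ \ I))))
    (ENNReal.ofReal (Real.exp (64 * v ^ 2 * l ^ 2 * ‖L‖ ^ 2 * ∑ i, ‖L (b i)‖ ^ 2)))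
    (fun I _ => ?_)
  · convert key using 5 with ω
    have := sum_powerset_inner_sum_sdiff (fun i => L (u i • r i ω)) Finset.univ
    simp only [← map_sum] at this
    simp only [map_smul, norm_smul, mul_pow, Real.norm_eq_abs, sq_abs] at this
    rw [← Finset.mul_sum, eq_inv_mul_iff_mul_eq₀ hcard]
    simp_rw [mul_comm 4 l, mul_assoc l, ← Finset.mul_sum] at this ⊢
    rw [this]
    ring
  · have hI : ∀ J : Finset ι, SubGaussianVector μ (fun ω => ∑ i ∈ J, u i • r i ω) v := fun J =>
      SubGaussianVector.sum hv hr hind hsub u J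
        ((Finset.sum_le_univ_sum_of_nonneg fun i => sq_nonneg _).trans hu.le)
    have hindI : IndepFun (fun ω => ∑ i ∈ I, u i • r i ω)
        (fun ω => ∑ i ∈ Finset.univ \ I, u i • r i ω) μ := by
      have h := hind.indepFun_finset I (Finset.univ \ I) Finset.disjoint_sdiff hr
      have h2 := h.comp (φ := fun z => ∑ i : I, u i • z i)
        (ψ := fun z => ∑ i : (Finset.univ \ I : Finset ι), u i • z i) (by fun_prop) (by fun_prop)
      convert h2 using 2 with ω ω
      · exact (Finset.sum_coe_sort I fun i => u i • r i ω).symm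
      · exact (Finset.sum_coe_sort (Finset.univ \ I) fun i => u i • r i ω).symm
    have := SubGaussianVector.lintegral_exp_bilinear (θ := 4 * l) L b hb hv (hsum _) (hsum _)
      hindI (hI _) (hI _) (by nlinarith)
    convert this using 4
    ring

end Prob

/-! ### From convex concentration to the tail bound for one vector -/

section Column

variable {Ω : Type*} [MeasurableSpace Ω] {μ : Measure Ω} [IsProbabilityMeasure μ] {p : ℕ}
  {x : Ω → EuclideanSpace ℝ (Fin p)} {K : ℝ}

theorem ConvexConcentration.lintegral_exp_sq_le (hc : ConvexConcentration μ x K) (hK : 0 < K)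
    (hx : Measurable x) {g : EuclideanSpace ℝ (Fin p) → ℝ} {s : ℝ} (hs : 0 < s)
    (hg : LipschitzWith s.toNNReal g) (hconv : ConvexOn ℝ Set.univ g) :
    Integrable (fun ω => g (x ω)) μ ∧
      ∫⁻ ω, ENNReal.ofReal (Real.exp
        ((g (x ω) - ∫ ω', g (x ω') ∂μ) ^ 2 / (2 * (K * s) ^ 2))) ∂μ ≤ 3 := by
  have hφl : LipschitzWith 1 fun y => s⁻¹ * g y := by
    refine LipschitzWith.of_dist_le_mul fun y z => ?_
    have := hg.dist_le_mul y z
    rw [Real.coe_toNNReal s hs.le] at this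
    rw [Real.dist_eq, ← mul_sub, abs_mul, abs_of_pos (inv_pos.2 hs), ← Real.dist_eq]
    rw [NNReal.coe_one, one_mul, inv_mul_le_iff₀ hs]
    exact this
  have hφc : ConvexOn ℝ Set.univ fun y => s⁻¹ * g y := hconv.smul (inv_pos.2 hs).le
  obtain ⟨hi, ht⟩ := hc _ hφl hφc
  have hgi : Integrable (fun ω => g (x ω)) μ := by
    refine (hi.const_mul s).congr (.of_forall fun ω => ?_)
    simp only
    rw [mul_inv_cancel_left₀ hs.ne']
  refine ⟨hgi, XRModel.lintegral_exp_sq_le ((hg.continuous.measurable.comp hx).sub_const _)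
    (by positivity) fun t htp => ?_⟩
  have h := ht (t / s) (by positivity)
  rw [integral_const_mul] at h
  convert h using 3
  · ext ω
    rw [← mul_sub, abs_mul, abs_of_pos (inv_pos.2 hs), div_eq_inv_mul,
      mul_le_mul_iff_right₀ (inv_pos.2 hs)]
  · field_simp

theorem lipschitzWith_clm {V : Type*} [NormedAddCommGroup V] [NormedSpace ℝ V]
    {H : Type*} [NormedAddCommGroup H] [NormedSpace ℝ H] (L : V →L[ℝ] H) :
    LipschitzWith (‖L‖).toNNReal L := by
  rw [norm_toNNReal]
  exact L.lipschitz

omit [IsProbabilityMeasure μ] in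
theorem MeanZero.integral_inner (h : MeanZero μ x) (a : EuclideanSpace ℝ (Fin p)) :
    ∫ ω, inner ℝ a (x ω) ∂μ = 0 := by
  simp_rw [PiLp.inner_apply]
  rw [integral_finsetSum]
  · refine Finset.sum_eq_zero fun i _ => ?_
    simp only [RCLike.inner_apply, conj_trivial]
    rw [integral_mul_const, (h i).2, zero_mul]
  · intro i _
    simp only [RCLike.inner_apply, conj_trivial]
    exact (h i).1.mul_const _

omit [IsProbabilityMeasure μ] in
theorem Isotropic.integral_inner_sq (h : Isotropic μ x) (a : EuclideanSpace ℝ (Fin p)) :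
    Integrable (fun ω => inner ℝ a (x ω) ^ 2) μ ∧ ∫ ω, inner ℝ a (x ω) ^ 2 ∂μ = ‖a‖ ^ 2 := by
  have e : ∀ ω, inner ℝ a (x ω) ^ 2 = ∑ i, ∑ j, a i * a j * (x ω i * x ω j) := fun ω => by
    rw [PiLp.inner_apply, sq, Finset.sum_mul_sum]
    refine Finset.sum_congr rfl fun i _ => Finset.sum_congr rfl fun j _ => ?_
    simp only [RCLike.inner_apply, conj_trivial]
    ring
  simp_rw [e]
  have hi : ∀ i j, Integrable (fun ω => a i * a j * (x ω i * x ω j)) μ := fun i j =>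
    (h i j).1.const_mul _
  refine ⟨integrable_finsetSum _ fun i _ => integrable_finsetSum _ fun j _ => hi i j, ?_⟩
  rw [integral_finsetSum _ fun i _ => integrable_finsetSum _ fun j _ => hi i j]
  simp_rw [integral_finsetSum _ fun j _ => hi _ j, integral_const_mul, (h _ _).2]
  rw [EuclideanSpace.real_norm_sq_eq]
  simp [sq]

theorem ConvexConcentration.subGaussianVector (hc : ConvexConcentration μ x K) (hK : 0 < K)
    (hx : Measurable x) (hm : MeanZero μ x) : SubGaussianVector μ x (4 * K ^ 2) := by
  intro a
  rcases eq_or_ne a 0 with rfl | ha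
  · simp
  have hpos : 0 < ‖innerSL ℝ a‖ := by simpa using ha
  obtain ⟨hi, h3⟩ := hc.lintegral_exp_sq_le hK hx hpos (lipschitzWith_clm (innerSL ℝ a))
    ((innerSL ℝ a).toLinearMap.convexOn convex_univ)
  simp only [innerSL_apply_apply, hm.integral_inner, sub_zero, innerSL_apply_norm] at hi h3
  have := lintegral_exp_mul_le (by fun_prop) (by simpa [hK] using ha) h3 hi (hm.integral_inner a) 1
  simp only [one_mul, one_pow, mul_one] at this
  convert this using 3
  ring

/-- A coordinate has variance 1 by isotropy and at most `4K²` by concentration. This lower bound on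
`K` lets powers `K²` be absorbed into `K⁴`. -/
theorem quarter_le_sq (hc : ConvexConcentration μ x K) (hK : 0 < K)
    (hx : Measurable x) (hm : MeanZero μ x) (hiso : Isotropic μ x) (hp : 0 < p) :
    1 / 4 ≤ K ^ 2 := by
  set a : EuclideanSpace ℝ (Fin p) := EuclideanSpace.single ⟨0, hp⟩ 1
  have ha : ‖a‖ = 1 := by simp [a]
  obtain ⟨hi, h3⟩ := hc.lintegral_exp_sq_le hK hx (s := ‖innerSL ℝ a‖) (by simp [ha])
    (lipschitzWith_clm (innerSL ℝ a)) ((innerSL ℝ a).toLinearMap.convexOn convex_univ)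
  simp only [innerSL_apply_apply, hm.integral_inner, sub_zero, innerSL_apply_norm, ha,
    mul_one] at hi h3
  have := (integral_sq_le (by fun_prop) hK h3).2
  rw [(hiso.integral_inner_sq a).2, ha] at this
  linarith

variable {F : Type*} [NormedAddCommGroup F] [InnerProductSpace ℝ F] {κ : Type*} [Fintype κ]

/-- Concentration is applied to the convex function `‖L ·‖`, around its mean `m`. Isotropy gives
`𝔼‖L x‖² = ∑ ‖L (b i)‖²`, so `m²` is at most this sum. -/
theorem lintegral_exp_norm_sq_sub_le (L : EuclideanSpace ℝ (Fin p) →L[ℝ] F) (hL : 0 < ‖L‖)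
    (b : OrthonormalBasis κ ℝ (EuclideanSpace ℝ (Fin p)))
    (hb : ∀ x y,
      inner ℝ (L x) (L y) = ∑ i, ‖L (b i)‖ ^ 2 * (inner ℝ (b i) x * inner ℝ (b i) y))
    (hc : ConvexConcentration μ x K) (hK : 0 < K) (hx : Measurable x) (hiso : Isotropic μ x)
    {l : ℝ} (hl : 4 * |l| * (K * ‖L‖) ^ 2 ≤ 1) :
    ∫⁻ ω, ENNReal.ofReal (Real.exp (l * (‖L (x ω)‖ ^ 2 - ∑ i, ‖L (b i)‖ ^ 2))) ∂μ ≤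
      ENNReal.ofReal (23 * Real.exp (64 * l ^ 2 * (∑ i, ‖L (b i)‖ ^ 2) * (K * ‖L‖) ^ 2)) := by
  have hF : ∫ ω, ‖L (x ω)‖ ^ 2 ∂μ = ∑ i, ‖L (b i)‖ ^ 2 := by
    simp_rw [← real_inner_self_eq_norm_sq (L (x _)), hb, ← sq (inner ℝ (b _) _)]
    rw [integral_finsetSum _ fun i _ => (hiso.integral_inner_sq (b i)).1.const_mul _]
    simp_rw [integral_const_mul, (hiso.integral_inner_sq _).2, b.orthonormal.1]
    simp
  have hlip : LipschitzWith (‖L‖).toNNReal fun y => ‖L y‖ := by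
    rw [← one_mul (‖L‖).toNNReal]
    exact lipschitzWith_one_norm.comp (lipschitzWith_clm L)
  have hconv : ConvexOn ℝ Set.univ fun y => ‖L y‖ :=
    convexOn_univ_norm.comp_linearMap L.toLinearMap
  obtain ⟨hi, h3⟩ := hc.lintegral_exp_sq_le hK hx hL hlip hconv
  set m := ∫ ω, ‖L (x ω)‖ ∂μ with hm
  have hWm : Measurable fun ω => ‖L (x ω)‖ - m :=
    (hlip.continuous.measurable.comp hx).sub_const _
  have hWi : Integrable (fun ω => ‖L (x ω)‖ - m) μ := hi.sub (integrable_const _)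
  have hW0 : ∫ ω, (‖L (x ω)‖ - m) ∂μ = 0 := by
    rw [integral_sub hi (integrable_const _)]
    simp [hm]
  have hW2 := (integral_sq_le hWm (by positivity) h3).1
  have e : ∀ ω, ‖L (x ω)‖ ^ 2 = (‖L (x ω)‖ - m) ^ 2 + (2 * m * (‖L (x ω)‖ - m) + m ^ 2) :=
    fun ω => by ring
  have hV : ∑ i, ‖L (b i)‖ ^ 2 = ∫ ω, (‖L (x ω)‖ - m) ^ 2 ∂μ + m ^ 2 := by
    have hB : Integrable (fun ω => 2 * m * (‖L (x ω)‖ - m) + m ^ 2) μ :=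
      (hWi.const_mul _).add (integrable_const _)
    rw [← hF, integral_congr_ae (.of_forall e), integral_add hW2 hB,
      integral_add (hWi.const_mul _) (integrable_const _), integral_const_mul, hW0]
    simp
  have hmF : m ^ 2 ≤ ∑ i, ‖L (b i)‖ ^ 2 := by
    have : 0 ≤ ∫ ω, (‖L (x ω)‖ - m) ^ 2 ∂μ := integral_nonneg fun ω => sq_nonneg _
    linarith
  have key := lintegral_exp_centered_sq_le (m := m) hWm (by positivity) h3 hWi hW0 hl
  calc _ = _ := by
        congr with ω
        congr 3
        rw [hV]
        ring
    _ ≤ _ := key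
    _ ≤ _ := by gcongr

theorem lintegral_exp_combination_le {ι : Type*} [Fintype ι]
    (L : EuclideanSpace ℝ (Fin p) →L[ℝ] F) (hL : 0 < ‖L‖)
    (b : OrthonormalBasis κ ℝ (EuclideanSpace ℝ (Fin p)))
    (hb : ∀ x y,
      inner ℝ (L x) (L y) = ∑ i, ‖L (b i)‖ ^ 2 * (inner ℝ (b i) x * inner ℝ (b i) y))
    {r : ι → Ω → EuclideanSpace ℝ (Fin p)} (hK : 0 < K) (hK4 : 1 / 4 ≤ K ^ 2)
    (hr : ∀ i, Measurable (r i)) (hind : iIndepFun r μ) (hmean : ∀ i, MeanZero μ (r i))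
    (hiso : ∀ i, Isotropic μ (r i)) (hc : ∀ i, ConvexConcentration μ (r i) K)
    (u : ι → ℝ) (hu : ∑ i, u i ^ 2 = 1) {l : ℝ} (hl : 8192 * K ^ 4 * l ^ 2 * ‖L‖ ^ 4 ≤ 1) :
    ∫⁻ ω, ENNReal.ofReal (Real.exp
      (l * (‖L (∑ i, u i • r i ω)‖ ^ 2 - ∑ i, ‖L (b i)‖ ^ 2))) ∂μ ≤
      ENNReal.ofReal (23 * Real.exp (4096 * K ^ 4 * l ^ 2 * ‖L‖ ^ 2 * ∑ i, ‖L (b i)‖ ^ 2)) := by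
  set S := ∑ i, ‖L (b i)‖ ^ 2 with hS
  have hS0 : 0 ≤ S := by positivity
  have hLm : ∀ i, Measurable fun ω => ‖L (r i ω)‖ ^ 2 := fun i =>
    ((L.continuous.norm.pow 2).measurable.comp (hr i))
  have hLs : Measurable fun ω => ‖L (∑ i, u i • r i ω)‖ ^ 2 :=
    (L.continuous.norm.pow 2).measurable.comp (by fun_prop)
  have e : ∀ ω, l * (‖L (∑ i, u i • r i ω)‖ ^ 2 - S) =
      l * (∑ i, u i ^ 2 * (‖L (r i ω)‖ ^ 2 - S)) +
      l * (‖L (∑ i, u i • r i ω)‖ ^ 2 - ∑ i, u i ^ 2 * ‖L (r i ω)‖ ^ 2) := fun ω => by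
    simp_rw [mul_sub, Finset.sum_sub_distrib]
    rw [← Finset.sum_mul, hu]
    ring
  simp_rw [e]
  refine lintegral_exp_add_le (by fun_prop) (by fun_prop) _ ?_ ?_
  · have e2 : ∀ ω, 2 * (l * (∑ i, u i ^ 2 * (‖L (r i ω)‖ ^ 2 - S))) =
        ∑ i, u i ^ 2 * (2 * l * (‖L (r i ω)‖ ^ 2 - S)) := fun ω => by
      rw [← mul_assoc, Finset.mul_sum]
      refine Finset.sum_congr rfl fun i _ => ?_
      ring
    simp_rw [e2]
    refine lintegral_exp_convexComb_le Finset.univ (fun i => u i ^ 2)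
      (fun i ω => 2 * l * (‖L (r i ω)‖ ^ 2 - S)) (fun i _ => sq_nonneg _) hu
      (fun i => by fun_prop) _ fun i _ => ?_
    refine (lintegral_exp_norm_sq_sub_le L hL b hb (hc i) hK (hr i) (hiso i) (l := 2 * l) ?_).trans
      (ENNReal.ofReal_le_ofReal ?_)
    · have h1 : (8 * |l| * (K * ‖L‖) ^ 2) ^ 2 ≤ 1 := by
        rw [mul_pow, mul_pow, sq_abs]
        have : 0 ≤ K ^ 4 * l ^ 2 * ‖L‖ ^ 4 := by positivity
        nlinarith
      have := (sq_le_one_iff₀ (by positivity)).1 h1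
      rw [abs_mul, abs_two]
      linarith
    · gcongr 23 * Real.exp ?_
      rw [← hS]
      have : 0 ≤ l ^ 2 * S * ‖L‖ ^ 2 * K ^ 2 := by positivity
      calc 64 * (2 * l) ^ 2 * S * (K * ‖L‖) ^ 2 = 256 * (l ^ 2 * S * ‖L‖ ^ 2 * K ^ 2) := by ring
        _ ≤ 4096 * (l ^ 2 * S * ‖L‖ ^ 2 * K ^ 2) * K ^ 2 := by nlinarith
        _ = _ := by ring
  · have h := lintegral_exp_offDiagonal_le L b hb (v := 4 * K ^ 2) (l := 2 * l) (by positivity)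
      hr hind (fun i => (hc i).subGaussianVector hK (hr i) (hmean i)) u hu (by
        calc _ = 8192 * K ^ 4 * l ^ 2 * ‖L‖ ^ 4 := by ring
          _ ≤ 1 := hl)
    simp_rw [← mul_assoc 2 l]
    refine h.trans (ENNReal.ofReal_le_ofReal ?_)
    rw [show 64 * (4 * K ^ 2) ^ 2 * (2 * l) ^ 2 * ‖L‖ ^ 2 * ∑ i, ‖L (b i)‖ ^ 2 =
      4096 * K ^ 4 * l ^ 2 * ‖L‖ ^ 2 * S by rw [← hS]; ring]
    linarith [Real.exp_pos (4096 * K ^ 4 * l ^ 2 * ‖L‖ ^ 2 * S)]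

/-- Concentration of `‖L (∑ i, u i • r i)‖ ^ 2` around the squared Hilbert–Schmidt norm of `L`. -/
theorem measure_abs_norm_sq_sub_ge_le {ι : Type*} [Fintype ι]
    (L : EuclideanSpace ℝ (Fin p) →L[ℝ] F) (hL : 0 < ‖L‖)
    (b : OrthonormalBasis κ ℝ (EuclideanSpace ℝ (Fin p)))
    (hb : ∀ x y,
      inner ℝ (L x) (L y) = ∑ i, ‖L (b i)‖ ^ 2 * (inner ℝ (b i) x * inner ℝ (b i) y))
    {r : ι → Ω → EuclideanSpace ℝ (Fin p)} (hK : 0 < K) (hK4 : 1 / 4 ≤ K ^ 2)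
    (hr : ∀ i, Measurable (r i)) (hind : iIndepFun r μ) (hmean : ∀ i, MeanZero μ (r i))
    (hiso : ∀ i, Isotropic μ (r i)) (hc : ∀ i, ConvexConcentration μ (r i) K)
    (u : ι → ℝ) (hu : ∑ i, u i ^ 2 = 1) {τ : ℝ} (hτ : 0 ≤ τ) (hτ1 : τ ≤ 1) :
    μ {ω | τ * (∑ i, ‖L (b i)‖ ^ 2) ≤
        |‖L (∑ i, u i • r i ω)‖ ^ 2 - ∑ i, ‖L (b i)‖ ^ 2|} ≤
      ENNReal.ofReal (46 * Real.exp
        (-(τ ^ 2 * ((∑ i, ‖L (b i)‖ ^ 2) / ‖L‖ ^ 2) / (16384 * K ^ 4)))) := by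
  set S := ∑ i, ‖L (b i)‖ ^ 2 with hS
  have hS0 : 0 ≤ S := by positivity
  -- The minimiser of the Chernoff exponent `4096 K⁴ l² ‖L‖² S - l τ S`.
  set l := τ / (8192 * K ^ 4 * ‖L‖ ^ 2) with hl
  have hl0 : 0 ≤ l := by positivity
  have hlb : 8192 * K ^ 4 * l ^ 2 * ‖L‖ ^ 4 ≤ 1 := by
    have e : 8192 * K ^ 4 * l ^ 2 * ‖L‖ ^ 4 = τ ^ 2 / (8192 * K ^ 4) := by
      rw [hl]; field_simp
    rw [e, div_le_one (by positivity)]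
    nlinarith
  have hLs : Measurable fun ω => ‖L (∑ i, u i • r i ω)‖ ^ 2 :=
    (L.continuous.norm.pow 2).measurable.comp (by fun_prop)
  set f : Ω → ℝ := fun ω => ‖L (∑ i, u i • r i ω)‖ ^ 2 - S with hf
  have hfm : Measurable f := hLs.sub_const _
  have chernoff : ∀ s : ℝ, s ^ 2 = 1 → μ {ω | τ * S ≤ s * f ω} ≤
      ENNReal.ofReal (23 * Real.exp (-(τ ^ 2 * (S / ‖L‖ ^ 2) / (16384 * K ^ 4)))) := by
    intro s hs
    have hint := lintegral_exp_combination_le L hL b hb hK hK4 hr hind hmean hiso hc u hu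
      (l := l * s) (by rw [mul_pow, hs, mul_one]; exact hlb)
    rw [mul_pow, hs, mul_one, ← hS] at hint
    calc μ {ω | τ * S ≤ s * f ω}
        ≤ μ {ω | ENNReal.ofReal (Real.exp (l * (τ * S))) ≤
            ENNReal.ofReal (Real.exp (l * s * f ω))} := by
          refine measure_mono fun ω hω => ENNReal.ofReal_le_ofReal (Real.exp_le_exp.2 ?_)
          rw [mul_assoc]
          exact mul_le_mul_of_nonneg_left hω hl0
      _ ≤ (∫⁻ ω, ENNReal.ofReal (Real.exp (l * s * f ω)) ∂μ) /
            ENNReal.ofReal (Real.exp (l * (τ * S))) :=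
          meas_ge_le_lintegral_div (by fun_prop) (by simp [Real.exp_pos]) ENNReal.ofReal_ne_top
      _ ≤ ENNReal.ofReal (23 * Real.exp (4096 * K ^ 4 * l ^ 2 * ‖L‖ ^ 2 * S)) /
            ENNReal.ofReal (Real.exp (l * (τ * S))) := by gcongr
      _ = _ := by
          rw [← ENNReal.ofReal_div_of_pos (Real.exp_pos _), mul_div_assoc, ← Real.exp_sub]
          congr 3
          rw [hl]
          field_simp
          ring
  calc _ ≤ μ ({ω | τ * S ≤ 1 * f ω} ∪ {ω | τ * S ≤ (-1) * f ω}) := by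
        refine measure_mono fun ω hω => ?_
        have hω : τ * S ≤ |f ω| := hω
        rcases le_abs.1 hω with h | h
        · left; simpa using h
        · right; simpa [hf] using h
    _ ≤ _ := (measure_union_le _ _).trans (add_le_add (chernoff 1 (by norm_num))
        (chernoff (-1) (by norm_num)))
    _ = _ := by
        rw [← ENNReal.ofReal_add (by positivity) (by positivity)]
        congr 1
        ring

end Column

/-! ### Nets for quadratic forms -/

section Net

variable (V : Type*) [NormedAddCommGroup V] [InnerProductSpace ℝ V] [FiniteDimensional ℝ V]

/-- A 1-separated set in the ball of radius 2 has at most `5 ^ finrank` points. A largest one is a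
1-net of that ball, and is scaled by one half. -/
theorem exists_half_net : ∃ N : Finset V, N.card ≤ 5 ^ Module.finrank ℝ V ∧
    ∀ u : V, ‖u‖ ≤ 1 → ∃ v ∈ N, ‖u - v‖ ≤ 1 / 2 := by
  classical
  let P : ℕ → Prop := fun n => ∃ s : Finset V, s.card = n ∧ (∀ c ∈ s, ‖c‖ ≤ 2) ∧
    ∀ c ∈ s, ∀ d ∈ s, c ≠ d → 1 ≤ ‖c - d‖
  have hP0 : P 0 := ⟨∅, by simp⟩
  obtain ⟨s, hs, hs2, hsep⟩ : P (Nat.findGreatest P (5 ^ Module.finrank ℝ V)) :=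
    Nat.findGreatest_spec (Nat.zero_le _) hP0
  refine ⟨s.image fun v => (2⁻¹ : ℝ) • v, Finset.card_image_le.trans
    (hs ▸ Nat.findGreatest_le _), fun u hu => ?_⟩
  · obtain ⟨c, hc, hcu⟩ : ∃ c ∈ s, ‖(2 : ℝ) • u - c‖ ≤ 1 := by
      by_contra! h
      have hnot : (2 : ℝ) • u ∉ s := fun hm => by
        have := h _ hm
        simp at this
        linarith
      have hsep' : ∀ c ∈ insert ((2 : ℝ) • u) s, ∀ d ∈ insert ((2 : ℝ) • u) s, c ≠ d →
          1 ≤ ‖c - d‖ := by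
        intro c hc d hd hcd
        rcases Finset.mem_insert.1 hc with rfl | hc <;> rcases Finset.mem_insert.1 hd with rfl | hd
        · exact absurd rfl hcd
        · exact (h d hd).le
        · rw [norm_sub_rev]; exact (h c hc).le
        · exact hsep c hc d hd hcd
      have h2 : ∀ c ∈ insert ((2 : ℝ) • u) s, ‖c‖ ≤ 2 := by
        intro c hc
        rcases Finset.mem_insert.1 hc with rfl | hc
        · rw [norm_smul]; norm_num; linarith
        · exact hs2 c hc
      have hle := Besicovitch.card_le_of_separated _ h2 hsep'
      have := Nat.le_findGreatest hle (show P _ from ⟨_, rfl, h2, hsep'⟩)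
      rw [Finset.card_insert_of_notMem hnot, hs] at this
      omega
    refine ⟨_, Finset.mem_image_of_mem _ hc, ?_⟩
    have e : u - (2⁻¹ : ℝ) • c = (2⁻¹ : ℝ) • ((2 : ℝ) • u - c) := by
      rw [smul_sub, smul_smul]
      norm_num
    rw [e, norm_smul]
    norm_num
    linarith

/-- A bound for `‖A v‖ ^ 2 - a * ‖v‖ ^ 2` on a suitable finite set extends to the whole space. -/
theorem exists_quadratic_net : ∃ N : Finset V, N.card ≤ 25 ^ Module.finrank ℝ V ∧
    ∀ {H : Type*} [NormedAddCommGroup H] [InnerProductSpace ℝ H] (A : V →L[ℝ] H) (a τ : ℝ), 0 ≤ τ →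
      (∀ v ∈ N, |‖A v‖ ^ 2 - a * ‖v‖ ^ 2| ≤ τ * ‖v‖ ^ 2) →
      ∀ u, |‖A u‖ ^ 2 - a * ‖u‖ ^ 2| ≤ 4 * τ * ‖u‖ ^ 2 := by
  classical
  obtain ⟨N, hcard, hN⟩ := exists_half_net V
  -- Approximating the remainder once more yields a 1/4-net. Radius 1/2 is too coarse for
  -- absorption: `‖u - z‖ ‖u + z‖` could reach 5/4, against `1/4 · 9/4 < 1` here.
  refine ⟨Finset.image₂ (fun v w => v + (2⁻¹ : ℝ) • w) N N, ?_, ?_⟩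
  · calc _ ≤ N.card * N.card := Finset.card_image₂_le _ _ _
      _ ≤ 5 ^ Module.finrank ℝ V * 5 ^ Module.finrank ℝ V := Nat.mul_le_mul hcard hcard
      _ = _ := by rw [← mul_pow]; norm_num
  intro H _ _ A a τ hτ hA
  have : ProperSpace V := FiniteDimensional.proper ℝ V
  let Q : V → ℝ := fun u => ‖A u‖ ^ 2 - a * ‖u‖ ^ 2
  obtain ⟨u₀, hu₀, hmax⟩ := (isCompact_closedBall (0 : V) 1).exists_isMaxOn ⟨0, by simp⟩
    (f := fun u => |Q u|) (by fun_prop)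
  set M := |Q u₀| with hM
  have hM0 : 0 ≤ M := abs_nonneg _
  have hQs : ∀ (c : ℝ) u, Q (c • u) = c ^ 2 * Q u := fun c u => by
    simp only [Q, map_smul, norm_smul, mul_pow, Real.norm_eq_abs, sq_abs]
    ring
  have hQM : ∀ u, |Q u| ≤ M * ‖u‖ ^ 2 := fun u => by
    rcases eq_or_ne u 0 with rfl | hu
    · simp [Q]
    have hpos : 0 < ‖u‖ := norm_pos_iff.2 hu
    have h1 : |Q (‖u‖⁻¹ • u)| ≤ M := hmax (by simp [norm_smul, hpos.ne'])
    rw [hQs, abs_mul, abs_of_nonneg (sq_nonneg _), inv_pow, inv_mul_le_iff₀ (by positivity)] at h1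
    linarith
  have hB : ∀ x y, |inner ℝ (A x) (A y) - a * inner ℝ x y| ≤ M / 2 * (‖x‖ ^ 2 + ‖y‖ ^ 2) :=
    fun x y => by
    have h1 := hQM (x + y)
    have h2 := hQM (x - y)
    have h3 : Q (x + y) - Q (x - y) = 4 * (inner ℝ (A x) (A y) - a * inner ℝ x y) := by
      simp only [Q, map_add, map_sub, norm_add_sq_real, norm_sub_sq_real]
      ring
    rw [norm_add_sq_real] at h1
    rw [norm_sub_sq_real] at h2
    rw [abs_le] at h1 h2 ⊢
    constructor <;> linarith [h1.1, h1.2, h2.1, h2.2]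
  have hu₀1 : ‖u₀‖ ≤ 1 := by simpa using hu₀
  obtain ⟨v, hv, huv⟩ := hN u₀ hu₀1
  obtain ⟨w, hw, huw⟩ := hN ((2 : ℝ) • (u₀ - v)) (by rw [norm_smul]; norm_num; linarith)
  set z := v + (2⁻¹ : ℝ) • w with hz
  have hzu : ‖u₀ - z‖ ≤ 1 / 4 := by
    have e : u₀ - z = (2⁻¹ : ℝ) • ((2 : ℝ) • (u₀ - v) - w) := by
      rw [hz, smul_sub, smul_smul, ← sub_sub]
      norm_num
    rw [e, norm_smul]
    norm_num
    linarith
  have hzn : ‖z‖ ≤ 5 / 4 := by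
    have := norm_sub_rev u₀ z
    linarith [norm_le_norm_add_norm_sub' z u₀]
  have hzp : ‖u₀ + z‖ ≤ 9 / 4 := (norm_add_le _ _).trans (by linarith)
  have hQz : |Q z| ≤ τ * (25 / 16) := (hA z (Finset.mem_image₂_of_mem hv hw)).trans (by
    gcongr
    nlinarith [norm_nonneg z])
  have hdiff : |Q u₀ - Q z| ≤ 9 / 16 * M := by
    -- The factors 3 and 1/3 balance the norm bounds 1/4 and 9/4, both becoming 3/4, before the
    -- bound by a sum of squares is used.
    have e : Q u₀ - Q z = inner ℝ (A ((3 : ℝ) • (u₀ - z))) (A ((3⁻¹ : ℝ) • (u₀ + z))) -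
        a * inner ℝ ((3 : ℝ) • (u₀ - z)) ((3⁻¹ : ℝ) • (u₀ + z)) := by
      simp only [map_smul, real_inner_smul_left, real_inner_smul_right, map_sub, map_add,
        inner_sub_left, inner_add_right, real_inner_self_eq_norm_sq, Q,
        real_inner_comm (A z) (A u₀), real_inner_comm z u₀]
      ring
    rw [e]
    refine (hB _ _).trans ?_
    rw [norm_smul, norm_smul]
    have h1 : ‖u₀ - z‖ ^ 2 ≤ 1 / 16 := by nlinarith [norm_nonneg (u₀ - z)]
    have h2 : ‖u₀ + z‖ ^ 2 ≤ 81 / 16 := by nlinarith [norm_nonneg (u₀ + z)]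
    have h3 : (‖(3 : ℝ)‖ * ‖u₀ - z‖) ^ 2 + (‖(3⁻¹ : ℝ)‖ * ‖u₀ + z‖) ^ 2 ≤ 9 / 8 := by
      norm_num [mul_pow]
      linarith
    nlinarith
  have hMτ : M ≤ 4 * τ := by
    have : |Q u₀| ≤ |Q z| + |Q u₀ - Q z| := by
      simpa using abs_add_le (Q z) (Q u₀ - Q z)
    linarith
  intro u
  exact (hQM u).trans (by gcongr)

end Net

/-! ### Counting supports and net points -/

theorem choose_le_exp {k d : ℕ} (hk : 1 ≤ k) (hkd : k ≤ d) :
    (d.choose k : ℝ) ≤ Real.exp (2 * (k * max 1 (Real.log ((d : ℝ) / k)))) := by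
  have hk0 : (0 : ℝ) < k := by exact_mod_cast hk
  have hd0 : (0 : ℝ) < d := hk0.trans_le (by exact_mod_cast hkd)
  have hf : (k : ℝ) ^ k / k.factorial ≤ Real.exp k := Real.pow_div_factorial_le_exp k hk0.le k
  calc (d.choose k : ℝ) ≤ (d : ℝ) ^ k / k.factorial := Nat.choose_le_pow_div k d
    _ = ((d : ℝ) / k) ^ k * ((k : ℝ) ^ k / k.factorial) := by
        rw [div_pow]
        field_simp
    _ ≤ ((d : ℝ) / k) ^ k * Real.exp k := by gcongr
    _ = Real.exp (k * Real.log ((d : ℝ) / k) + k) := by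
        rw [Real.exp_add, Real.exp_nat_mul, Real.exp_log (by positivity)]
    _ ≤ _ := by
        apply Real.exp_le_exp.2
        nlinarith [le_max_left 1 (Real.log ((d : ℝ) / k)), le_max_right 1 (Real.log ((d : ℝ) / k))]

theorem forty_six_le_exp_four : (46 : ℝ) ≤ Real.exp 4 := by
  have h := Real.exp_one_gt_d9
  have e : Real.exp 4 = Real.exp 1 ^ 4 := by rw [← Real.exp_nat_mul]; norm_num
  rw [e]
  calc (46 : ℝ) ≤ 2.7 ^ 4 := by norm_num
    _ ≤ _ := by gcongr; linarith

/-- With `Λ = k max(1, log(d/k))`, the three counting factors cost at most `(2 + 4 + 4)Λ`. Since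
`5242880 = 10 · 524288`, half of the tail exponent pays for them. -/
theorem card_mul_tail_le {k d : ℕ} {T : ℝ} (hk : 1 ≤ k) (hkd : k ≤ d)
    (hT : 5242880 * (k * max 1 (Real.log ((d : ℝ) / k))) ≤ T) :
    (d.choose k : ℝ) * (25 ^ k * (46 * Real.exp (-(T / 262144)))) ≤ Real.exp (-(T / 524288)) := by
  have hc := choose_le_exp hk hkd
  set Λ := (k : ℝ) * max 1 (Real.log ((d : ℝ) / k)) with hΛ
  have hk1 : (1 : ℝ) ≤ k := by exact_mod_cast hk
  have hΛk : (k : ℝ) ≤ Λ := by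
    nlinarith [le_max_left 1 (Real.log ((d : ℝ) / k))]
  have h25 : (25 : ℝ) ^ k ≤ Real.exp (4 * Λ) := by
    calc (25 : ℝ) ^ k ≤ Real.exp 4 ^ k := by
          gcongr
          linarith [forty_six_le_exp_four]
      _ = Real.exp (k * 4) := (Real.exp_nat_mul _ _).symm
      _ ≤ _ := Real.exp_le_exp.2 (by linarith)
  have h46 : (46 : ℝ) ≤ Real.exp (4 * Λ) :=
    forty_six_le_exp_four.trans (Real.exp_le_exp.2 (by linarith))
  calc _ ≤ Real.exp (2 * Λ) * (Real.exp (4 * Λ) * (Real.exp (4 * Λ) *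
          Real.exp (-(T / 262144)))) := by gcongr
    _ = Real.exp (10 * Λ - T / 262144) := by
        rw [← Real.exp_add, ← Real.exp_add, ← Real.exp_add]
        congr 1
        ring
    _ ≤ _ := Real.exp_le_exp.2 (by linarith)

/-! ### Matrices as operators -/

section Matrix

variable {n p d : ℕ}

/-- Parseval for each row of `X`: the Frobenius norm may be computed in the singular basis. -/
theorem frobNorm_sq (X : Matrix (Fin n) (Fin p) ℝ) {κ : Type*} [Fintype κ]
    (b : OrthonormalBasis κ ℝ (EuclideanSpace ℝ (Fin p))) :
    frobNorm X ^ 2 = ∑ i, ‖LinearMap.toContinuousLinearMap (Matrix.toEuclideanLin X) (b i)‖ ^ 2 := by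
  rw [frobNorm, Real.sq_sqrt (by positivity)]
  simp_rw [EuclideanSpace.real_norm_sq_eq]
  rw [Finset.sum_comm (γ := κ)]
  refine Finset.sum_congr rfl fun i _ => ?_
  have := b.sum_sq_inner_left (WithLp.toLp 2 (X i))
  rw [EuclideanSpace.real_norm_sq_eq] at this
  simp only at this
  rw [← this]
  refine Finset.sum_congr rfl fun j _ => ?_
  congr 1
  simp [PiLp.inner_apply, Matrix.toLpLin_apply, Matrix.mulVec, dotProduct, mul_comm]

theorem toEuclideanLin_mul_apply (X : Matrix (Fin n) (Fin p) ℝ) (R : Matrix (Fin p) (Fin d) ℝ)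
    (u : EuclideanSpace ℝ (Fin d)) :
    Matrix.toEuclideanLin (X * R) u = Matrix.toEuclideanLin X (∑ j, u j • column R j) := by
  have : ∑ j, u j • column R j = Matrix.toEuclideanLin R u := by
    ext i
    simp [column, Matrix.toLpLin_apply, Matrix.mulVec, dotProduct, mul_comm]
  rw [this]
  simp [Matrix.toLpLin_apply]

end Matrix

/-! ### Union bound over supports and nets -/

section Final

variable {Ω : Type*} [MeasurableSpace Ω] {μ : Measure Ω} [IsProbabilityMeasure μ] {p : ℕ} {K : ℝ}
  {F : Type*} [NormedAddCommGroup F] [InnerProductSpace ℝ F]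

theorem bounds_of_abs_sq_sub_le {y f ε : ℝ} (hy : 0 ≤ y) (hf : 0 ≤ f) (hε : 0 < ε) (hε1 : ε < 1)
    (h : |y ^ 2 - f ^ 2| ≤ ε * f ^ 2) : (1 - ε) * f ≤ y ∧ y ≤ (1 + ε) * f := by
  obtain ⟨h1, h2⟩ := abs_le.1 h
  have hf2 : 0 ≤ f ^ 2 := sq_nonneg f
  constructor
  · refine le_of_sq_le_sq ?_ hy
    nlinarith [mul_nonneg (mul_nonneg hε.le (sub_nonneg.2 hε1.le)) hf2]
  · refine le_of_sq_le_sq ?_ (by positivity)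
    nlinarith [mul_nonneg hε.le hf2, mul_nonneg (mul_nonneg hε.le hε.le) hf2]

/-- The linear map `v ↦ ∑ i, v i • y i`. -/
noncomputable def combinationMap {ι : Type*} [Fintype ι] (y : ι → F) :
    EuclideanSpace ℝ ι →L[ℝ] F :=
  ∑ i, (EuclideanSpace.proj i : EuclideanSpace ℝ ι →L[ℝ] ℝ).smulRight (y i)

theorem combinationMap_apply {ι : Type*} [Fintype ι] (y : ι → F) (v : EuclideanSpace ℝ ι) :
    combinationMap y v = ∑ i, v i • y i := by
  simp [combinationMap]

/-- Net points need not be unit vectors, so the tail bound is extended by homogeneity. The negated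
form makes the event empty at `v = 0`. -/
theorem measure_combinationMap_le {ι κ : Type*} [Fintype ι] [Fintype κ]
    (L : EuclideanSpace ℝ (Fin p) →L[ℝ] F) (hL : 0 < ‖L‖)
    (b : OrthonormalBasis κ ℝ (EuclideanSpace ℝ (Fin p)))
    (hb : ∀ x y,
      inner ℝ (L x) (L y) = ∑ i, ‖L (b i)‖ ^ 2 * (inner ℝ (b i) x * inner ℝ (b i) y))
    {r : ι → Ω → EuclideanSpace ℝ (Fin p)} (hK : 0 < K) (hK4 : 1 / 4 ≤ K ^ 2)
    (hr : ∀ i, Measurable (r i)) (hind : iIndepFun r μ) (hmean : ∀ i, MeanZero μ (r i))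
    (hiso : ∀ i, Isotropic μ (r i)) (hc : ∀ i, ConvexConcentration μ (r i) K)
    (v : EuclideanSpace ℝ ι) {τ : ℝ} (hτ : 0 ≤ τ) (hτ1 : τ ≤ 1) :
    μ {ω | ¬ |‖combinationMap (fun i => L (r i ω)) v‖ ^ 2 - (∑ i, ‖L (b i)‖ ^ 2) * ‖v‖ ^ 2| ≤
        τ * (∑ i, ‖L (b i)‖ ^ 2) * ‖v‖ ^ 2} ≤
      ENNReal.ofReal (46 * Real.exp
        (-(τ ^ 2 * ((∑ i, ‖L (b i)‖ ^ 2) / ‖L‖ ^ 2) / (16384 * K ^ 4)))) := by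
  rcases eq_or_ne v 0 with rfl | hv
  · simp
  have hpos : 0 < ‖v‖ := norm_pos_iff.2 hv
  refine (measure_mono fun ω hω => ?_).trans (measure_abs_norm_sq_sub_ge_le L hL b hb hK hK4 hr hind
    hmean hiso hc (fun i => (‖v‖⁻¹ • v) i) ?_ hτ hτ1)
  · have hω : τ * (∑ i, ‖L (b i)‖ ^ 2) * ‖v‖ ^ 2 <
      |‖combinationMap (fun i => L (r i ω)) v‖ ^ 2 - (∑ i, ‖L (b i)‖ ^ 2) * ‖v‖ ^ 2| := not_le.1 hω
    have e : L (∑ i, (‖v‖⁻¹ • v) i • r i ω) =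
        ‖v‖⁻¹ • combinationMap (fun i => L (r i ω)) v := by
      rw [← map_smul, combinationMap_apply]
      simp
    show _ ≤ |‖L (∑ i, (‖v‖⁻¹ • v) i • r i ω)‖ ^ 2 - _|
    have e2 : ‖L (∑ i, (‖v‖⁻¹ • v) i • r i ω)‖ ^ 2 - ∑ i, ‖L (b i)‖ ^ 2 = (‖v‖ ^ 2)⁻¹ *
        (‖combinationMap (fun i => L (r i ω)) v‖ ^ 2 - (∑ i, ‖L (b i)‖ ^ 2) * ‖v‖ ^ 2) := by
      rw [e, norm_smul, norm_inv, norm_norm]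
      field_simp
    rw [e2, abs_mul, abs_of_pos (inv_pos.2 (by positivity)), le_inv_mul_iff₀ (by positivity)]
    linarith
  · rw [← EuclideanSpace.real_norm_sq_eq, norm_smul, norm_inv, norm_norm,
      inv_mul_cancel₀ hpos.ne', one_pow]

/-- A vector with few nonzero coordinates restricts isometrically to a set of `k` coordinates. -/
theorem IsSparseUnit.exists_restrict {d k : ℕ} (hkd : k ≤ d) {u : EuclideanSpace ℝ (Fin d)}
    (hu : IsSparseUnit k u) :
    ∃ S ∈ (Finset.univ : Finset (Fin d)).powersetCard k, ∃ v : EuclideanSpace ℝ S, ‖v‖ = 1 ∧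
      ∀ y : Fin d → F, combinationMap (fun i : S => y i) v = ∑ j, u j • y j := by
  classical
  obtain ⟨hu1, hcard⟩ := hu
  have hc : (Finset.univ.filter fun j => u j ≠ 0).card ≤ k := by
    rwa [← Set.ncard_coe_finset, Finset.coe_filter_univ]
  -- The support is padded to exactly `k` coordinates, possible because `k ≤ d`, so that only sets
  -- of size `k` enter the union bound.
  obtain ⟨S, hsub, -, hS⟩ := Finset.exists_subsuperset_card_eq
    (Finset.subset_univ (Finset.univ.filter fun j => u j ≠ 0)) hc (by simpa using hkd)
  have h0 : ∀ j ∉ S, u j = 0 := fun j hj => by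
    by_contra h
    exact hj (hsub (by simpa using h))
  refine ⟨S, by simp [hS], WithLp.toLp 2 fun i => u i, ?_, fun y => ?_⟩
  · rw [← sq_eq_sq₀ (norm_nonneg _) zero_le_one, ← hu1, EuclideanSpace.real_norm_sq_eq,
      EuclideanSpace.real_norm_sq_eq]
    simp only
    rw [Finset.sum_coe_sort S fun j => u j ^ 2]
    exact Finset.sum_subset (Finset.subset_univ _) fun j _ hj => by simp [h0 j hj]
  · rw [combinationMap_apply]
    simp only
    rw [Finset.sum_coe_sort S fun j => u j • y j]
    exact Finset.sum_subset (Finset.subset_univ _) fun j _ hj => by simp [h0 j hj]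

end Final

theorem productRIP_probability {Ω : Type*} [MeasurableSpace Ω] (μ : Measure Ω)
    [IsProbabilityMeasure μ] (n p d : ℕ) (X : Matrix (Fin n) (Fin p) ℝ)
    (R : Ω → Matrix (Fin p) (Fin d) ℝ) (K ε : ℝ) (k : ℕ) (hK : 0 < K) (hε : 0 < ε) (hε1 : ε < 1)
    (hk : 1 ≤ k) (hkd : k ≤ d) (hr : ∀ j : Fin d, Measurable (fun ω => column (R ω) j))
    (hind : iIndepFun (fun (j : Fin d) (ω : Ω) => column (R ω) j) μ)
    (hmean : ∀ j : Fin d, MeanZero μ (fun ω => column (R ω) j))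
    (hiso : ∀ j : Fin d, Isotropic μ (fun ω => column (R ω) j))
    (hc : ∀ j : Fin d, ConvexConcentration μ (fun ω => column (R ω) j) K)
    (hsr : 5242880 * K ^ 4 * ((k : ℝ) / ε ^ 2) * max 1 (Real.log ((d : ℝ) / (k : ℝ))) ≤
      stableRank X) :
    1 - Real.exp (-(1 / 524288) * ε ^ 2 * stableRank X / K ^ 4) ≤
      μ.real {ω | ProductRIP X (R ω) k ε} := by
  have hk0 : (0 : ℝ) < k := by exact_mod_cast hk
  set L := LinearMap.toContinuousLinearMap (Matrix.toEuclideanLin X) with hLdef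
  have hmax : (0 : ℝ) < max 1 (Real.log ((d : ℝ) / (k : ℝ))) :=
    zero_lt_one.trans_le (le_max_left _ _)
  have hsr0 : 0 < stableRank X := lt_of_lt_of_le (by positivity) hsr
  -- Division by zero gives stable rank 0 when the spectral norm vanishes, so positivity of the
  -- stable rank forces `L ≠ 0`.
  have hL : 0 < ‖L‖ := by
    refine (norm_nonneg L).lt_of_ne fun h => ?_
    have : specNorm X = 0 := h.symm
    simp [stableRank, this] at hsr0
  have hp : 0 < p := by
    rcases Nat.eq_zero_or_pos p with rfl | h
    · rw [Subsingleton.elim L 0, norm_zero] at hL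
      exact absurd hL (lt_irrefl _)
    · exact h
  have hK4 : 1 / 4 ≤ K ^ 2 :=
    quarter_le_sq (hc ⟨0, hk.trans hkd⟩) hK (hr _) (hmean _) (hiso _) hp
  obtain ⟨b, hb⟩ := exists_singular_basis L
  have hF := frobNorm_sq X b
  rw [← hLdef] at hF
  have hsrdef : stableRank X = (∑ i, ‖L (b i)‖ ^ 2) / ‖L‖ ^ 2 := by rw [← hF]; rfl
  have hF0 : 0 ≤ frobNorm X := Real.sqrt_nonneg _
  -- The nets depend on the support alone and not on `ω`, as the union bound requires.
  choose N hNcard hN using fun S : Finset (Fin d) => exists_quadratic_net (EuclideanSpace ℝ S)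
  -- Tolerance `ε / 4`, because passing from the net to all vectors loses a factor 4. Hence `262144
  -- = 16 · 16384` below.
  let bad : (S : Finset (Fin d)) → EuclideanSpace ℝ S → Set Ω := fun S v =>
    {ω | ¬ |‖combinationMap (fun i : S => L (column (R ω) i)) v‖ ^ 2 -
      (∑ i, ‖L (b i)‖ ^ 2) * ‖v‖ ^ 2| ≤ ε / 4 * (∑ i, ‖L (b i)‖ ^ 2) * ‖v‖ ^ 2}
  let B : Set Ω := ⋃ S ∈ (Finset.univ : Finset (Fin d)).powersetCard k, ⋃ v ∈ N S, bad S v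
  set T := ε ^ 2 * stableRank X / K ^ 4 with hT
  have hbad : ∀ S v, μ.real (bad S v) ≤ 46 * Real.exp (-(T / 262144)) := fun S v => by
    have h := measure_combinationMap_le L hL b hb (r := fun (i : S) ω => column (R ω) i) hK hK4
      (fun i => hr i) (hind.precomp Subtype.val_injective) (fun i => hmean i) (fun i => hiso i)
      (fun i => hc i) v (τ := ε / 4) (by positivity) (by linarith)
    refine ENNReal.toReal_le_of_le_ofReal (by positivity) (h.trans_eq ?_)
    rw [← hsrdef, hT]
    congr 4
    field_simp
    ring
  have hBμ : μ.real B ≤ Real.exp (-(T / 524288)) := by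
    calc μ.real B ≤ ∑ S ∈ (Finset.univ : Finset (Fin d)).powersetCard k,
            μ.real (⋃ v ∈ N S, bad S v) := measureReal_biUnion_finset_le _ _
      _ ≤ ∑ S ∈ (Finset.univ : Finset (Fin d)).powersetCard k,
            25 ^ k * (46 * Real.exp (-(T / 262144))) := by
          refine Finset.sum_le_sum fun S hS => (measureReal_biUnion_finset_le _ _).trans ?_
          have hcS : S.card = k := (Finset.mem_powersetCard.1 hS).2
          calc _ ≤ ∑ v ∈ N S, 46 * Real.exp (-(T / 262144)) :=
                Finset.sum_le_sum fun v _ => hbad S v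
            _ = (N S).card * (46 * Real.exp (-(T / 262144))) := by
                rw [Finset.sum_const, nsmul_eq_mul]
            _ ≤ _ := by
                gcongr
                have := hNcard S
                rw [finrank_euclideanSpace, Fintype.card_coe, hcS] at this
                exact_mod_cast this
      _ = (d.choose k : ℝ) * (25 ^ k * (46 * Real.exp (-(T / 262144)))) := by
          rw [Finset.sum_const, nsmul_eq_mul, Finset.card_powersetCard, Finset.card_univ,
            Fintype.card_fin]
      _ ≤ _ := by
          refine card_mul_tail_le hk hkd ?_
          rw [hT, le_div_iff₀ (by positivity), ← div_le_iff₀' (by positivity)]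
          refine le_trans (le_of_eq ?_) hsr
          field_simp
  have hgood : Bᶜ ⊆ {ω | ProductRIP X (R ω) k ε} := by
    intro ω hω u hu
    obtain ⟨S, hS, v, hv1, hv⟩ := hu.exists_restrict (F := EuclideanSpace ℝ (Fin n)) hkd
    have hnet : ∀ w ∈ N S, |‖combinationMap (fun i : S => L (column (R ω) i)) w‖ ^ 2 -
        (∑ i, ‖L (b i)‖ ^ 2) * ‖w‖ ^ 2| ≤ ε / 4 * (∑ i, ‖L (b i)‖ ^ 2) * ‖w‖ ^ 2 := by
      intro w hw
      by_contra h
      exact hω (Set.mem_biUnion hS (Set.mem_biUnion hw h))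
    have h := hN S (combinationMap (fun i : S => L (column (R ω) i))) _ _ (by positivity) hnet v
    rw [hv fun j => L (column (R ω) j), hv1, ← hF] at h
    have e : Matrix.toEuclideanLin (X * R ω) u = ∑ j, u j • L (column (R ω) j) := by
      rw [toEuclideanLin_mul_apply, map_sum]
      simp [hLdef]
    rw [e]
    refine bounds_of_abs_sq_sub_le (norm_nonneg _) hF0 hε hε1 ?_
    simp only [one_pow, mul_one] at h
    linarith
  -- Subadditivity suffices here, so measurability of `B` plays no role.
  have h1 : 1 ≤ μ.real B + μ.real Bᶜ := by
    have := measureReal_union_le (μ := μ) B Bᶜ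
    rwa [Set.union_compl_self, probReal_univ] at this
  have h2 := measureReal_mono hgood (measure_ne_top μ _)
  have e : -(1 / 524288) * ε ^ 2 * stableRank X / K ^ 4 = -(T / 524288) := by
    rw [hT]
    ring
  rw [e]
  linarith

end XRModel

theorem mainTheorem4 :
    ∃ C c : ℝ, 0 < C ∧ 0 < c ∧
      ∀ {Ω : Type*} [MeasurableSpace Ω] (μ : Measure Ω) [IsProbabilityMeasure μ]
        (n p d : ℕ) (X : Matrix (Fin n) (Fin p) ℝ) (R : Ω → Matrix (Fin p) (Fin d) ℝ)
        (K ε : ℝ) (k : ℕ),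
        0 < K → 0 < ε → ε < 1 → 1 ≤ k → k ≤ d →
        (∀ j : Fin d, Measurable (fun ω => XRModel.column (R ω) j)) →
        iIndepFun (fun (j : Fin d) (ω : Ω) => XRModel.column (R ω) j) μ →
        (∀ j : Fin d, XRModel.MeanZero μ (fun ω => XRModel.column (R ω) j)) →
        (∀ j : Fin d, XRModel.Isotropic μ (fun ω => XRModel.column (R ω) j)) →
        (∀ j : Fin d, XRModel.ConvexConcentration μ (fun ω => XRModel.column (R ω) j) K) →
        C * K ^ 4 * ((k : ℝ) / ε ^ 2) * max 1 (Real.log ((d : ℝ) / (k : ℝ))) ≤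
          XRModel.stableRank X →
        1 - Real.exp (-c * ε ^ 2 * XRModel.stableRank X / K ^ 4) ≤
          μ.real {ω | XRModel.ProductRIP X (R ω) k ε} :=
  ⟨5242880, 1 / 524288, by norm_num, by norm_num, fun μ _ n p d X R K ε k =>
    XRModel.productRIP_probability μ n p d X R K ε k⟩
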